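/- Let $\mathcal F^2$ be the Fock space of entire functions $F:\mathbb C\to\mathbb C$ with $\|F\|^2=\int_{\mathbb C}|F(z)|^2e^{-\pi|z|^2}\,dA(z)<\infty$, where $dA$ is Lebesgue measure, and let $P$ be the orthogonal projection of $L^2(\mathbb C,e^{-\pi|z|^2}dA)$ onto $\mathcal F^2$. For a measurable set $\Omega\subset\mathbb C$ of finite area $|\Omega|$, let $T_\Omega=P\chi_\Omega:\mathcal F^2\to\mathcal F^2$ be the associated Toeplitz operator (which is compact, positive and self-adjoint), and let $\lambda_1(\Omega)\ge\lambda_2(\Omega)\ge\cdots$ be its eigenvalues, listed in decreasing order and repeated according to multiplicity. Let $\Omega\subset\mathbb C$ be a measurable set with $0<|\Omega|<\infty$ which is circularly symmetric, i.e. $\Omega=\{z\in\mathbb C: |z-w|\in E\}$ for some $w\in\mathbb C$ and some measurable $E\subset[0,\infty)$, and let $\Omega^*$ be a ball (with any center) such that $|\Omega^*|=|\Omega|$. Then, for every $n\ge1$ and every symmetric gauge function $f$ on $\mathbb R^n$ (that is, a norm $f$ on $\mathbb R^n$ such that $f(x_1,\dots,x_n)=f(|x_1|,\dots,|x_n|)$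 and $f(x_{\sigma(1)},\dots,x_{\sigma(n)})=f(x_1,\dots,x_n)$ for every $x\in\mathbb R^n$ and every permutation $\sigma$ of $\{1,\dots,n\}$), $$f\big(\lambda_1(\Omega),\dots,\lambda_n(\Omega)\big)\le f\big(\lambda_1(\Omega^*),\dots,\lambda_n(\Omega^*)\big).$$ -/

import Mathlib

open MeasureTheory Filter Topology Real

noncomputable section

namespace Fock

/-- The Gaussian measure `exp (-π |z|²) dA(z)` on the complex plane. -/
def gaussian : Measure ℂ :=
  (volume : Measure ℂ).withDensity fun z => ENNReal.ofReal (Real.exp (-π * ‖z‖ ^ 2))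

theorem gaussian_ac : gaussian ≪ (volume : Measure ℂ) := withDensity_absolutelyContinuous _ _

theorem measurable_density :
    Measurable fun z : ℂ => ENNReal.ofReal (Real.exp (-π * ‖z‖ ^ 2)) := by
  fun_prop

/-- The Fock space: the elements of `L²(ℂ, exp (-π |z|²) dA)` that are represented by an entire
function, with the inner product of that `L²` space. -/
def fockSpace : Submodule ℂ (Lp ℂ 2 gaussian) where
  carrier := {f | ∃ F : ℂ → ℂ, Differentiable ℂ F ∧ f =ᵐ[gaussian] F}
  add_mem' := by
    rintro f g ⟨F, hF, hf⟩ ⟨G, hG, hg⟩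
    exact ⟨F + G, hF.add hG, (Lp.coeFn_add f g).trans (hf.add hg)⟩
  zero_mem' := ⟨0, differentiable_const 0, Lp.coeFn_zero _ _ _⟩
  smul_mem' := by
    rintro c f ⟨F, hF, hf⟩
    exact ⟨c • F, hF.const_smul c, (Lp.coeFn_smul c f).trans (hf.const_smul c)⟩

section Closed

/-- Mean value inequality on a circle. -/
theorem circle_bound {F : ℂ → ℂ} (hF : Differentiable ℂ F) (z : ℂ) (r : ℝ) :
    ENNReal.ofReal (2 * π) * ‖F z‖ₑ ^ 2 ≤
      ∫⁻ θ in Set.Ioo (-π) π,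
        ‖F (z + r * (Real.cos θ + Real.sin θ * Complex.I))‖ₑ ^ 2 := by
  set G : ℂ → ℂ := fun w => F w ^ 2 with hG
  have hGd : Differentiable ℂ G := hF.pow 2
  have h1 : Real.circleAverage G z r = G z := hGd.diffContOnCl.circleAverage
  have h2 : (∫ θ in (-π)..π, G (circleMap z r θ)) = (2 * π : ℝ) • G z := by
    have hp : Function.Periodic (fun θ => G (circleMap z r θ)) (2 * π) := fun θ => by
      simp only [periodic_circleMap z r θ]
    have h3 := hp.intervalIntegral_add_eq (-π) 0
    rw [show -π + 2 * π = π by ring, zero_add] at h3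
    rw [h3, ← h1, Real.circleAverage_def, smul_smul, mul_inv_cancel₀ (by positivity), one_smul]
  have h4 : ‖(2 * π : ℝ) • G z‖ₑ ≤ ∫⁻ θ in Set.Ioc (-π) π, ‖G (circleMap z r θ)‖ₑ := by
    rw [← h2, intervalIntegral.integral_of_le (by linarith [Real.pi_pos])]
    exact enorm_integral_le_lintegral_enorm _
  rw [restrict_Ioo_eq_restrict_Ioc]
  have h5 : ‖(2 * π : ℝ)‖ₑ = ENNReal.ofReal (2 * π) :=
    Real.enorm_eq_ofReal (by positivity)
  rw [enorm_smul, h5] at h4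
  simp only [hG, enorm_pow] at h4
  refine h4.trans (le_of_eq ?_)
  refine lintegral_congr fun θ => ?_
  congr 3
  simp [circleMap, Complex.exp_mul_I]

/-- Mean value inequality on a unit disc. -/
theorem disc_bound {F : ℂ → ℂ} (hF : Differentiable ℂ F) (z : ℂ) :
    ‖F z‖ₑ ^ 2 ≤ ∫⁻ w in Metric.closedBall z 1, ‖F w‖ₑ ^ 2 := by
  have hm : Measurable fun w => ‖F w‖ₑ ^ 2 := (hF.continuous.measurable.enorm).pow_const 2
  have e1 : ∫⁻ w in Metric.closedBall z 1, ‖F w‖ₑ ^ 2 =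
      ∫⁻ w, (Metric.closedBall (0 : ℂ) 1).indicator (fun w => ‖F (z + w)‖ₑ ^ 2) w := by
    rw [← lintegral_indicator Metric.isClosed_closedBall.measurableSet,
      ← lintegral_add_left_eq_self _ z]
    refine lintegral_congr fun w => ?_
    have hw : z + w ∈ Metric.closedBall z 1 ↔ w ∈ Metric.closedBall (0 : ℂ) 1 := by
      rw [mem_closedBall_zero_iff, Metric.mem_closedBall, dist_eq_norm, add_sub_cancel_left]
    by_cases h : w ∈ Metric.closedBall (0 : ℂ) 1
    · rw [Set.indicator_of_mem h, Set.indicator_of_mem (hw.2 h)]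
    · rw [Set.indicator_of_notMem h, Set.indicator_of_notMem (mt hw.1 h)]
  rw [e1, ← Complex.lintegral_comp_polarCoord_symm]
  have e2 : (∫⁻ p in Set.Ioc (0 : ℝ) 1 ×ˢ Set.Ioo (-π) π, ENNReal.ofReal p.1 *
      ‖F (z + p.1 * (Real.cos p.2 + Real.sin p.2 * Complex.I))‖ₑ ^ 2) ≤
      ∫⁻ p in polarCoord.target, ENNReal.ofReal p.1 •
        (Metric.closedBall (0 : ℂ) 1).indicator (fun w => ‖F (z + w)‖ₑ ^ 2)
          (Complex.polarCoord.symm p) := by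
    have hsub : Set.Ioc (0 : ℝ) 1 ×ˢ Set.Ioo (-π) π ⊆ polarCoord.target := by
      rintro p ⟨h1, h2⟩
      exact ⟨h1.1, h2⟩
    refine le_trans (le_of_eq ?_) (lintegral_mono_set hsub)
    refine setLIntegral_congr_fun (measurableSet_Ioc.prod measurableSet_Ioo) fun p hp => ?_
    have hmem : Complex.polarCoord.symm p ∈ Metric.closedBall (0 : ℂ) 1 := by
      rw [mem_closedBall_zero_iff, Complex.norm_polarCoord_symm, abs_of_pos hp.1.1]
      exact hp.1.2
    rw [Set.indicator_of_mem hmem, smul_eq_mul, Complex.polarCoord_symm_apply]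
  refine le_trans ?_ e2
  rw [Measure.volume_eq_prod, ← Measure.prod_restrict, lintegral_prod _ (by
    refine Measurable.aemeasurable ?_
    refine Measurable.mul (by fun_prop) (hm.comp ?_)
    fun_prop)]
  calc ‖F z‖ₑ ^ 2 ≤ ∫⁻ r in Set.Ioc (0 : ℝ) 1, ENNReal.ofReal r *
        (ENNReal.ofReal (2 * π) * ‖F z‖ₑ ^ 2) := by
        rw [lintegral_mul_const _ (by fun_prop)]
        have : ∫⁻ r in Set.Ioc (0 : ℝ) 1, ENNReal.ofReal r = ENNReal.ofReal (1 / 2) := by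
          rw [← ofReal_integral_eq_lintegral_ofReal]
          · rw [← intervalIntegral.integral_of_le zero_le_one]
            simp
          · exact (continuous_id.integrableOn_Icc (a := (0 : ℝ)) (b := 1)).mono_set
              Set.Ioc_subset_Icc_self
          · exact (ae_restrict_iff' measurableSet_Ioc).2 (ae_of_all _ fun r hr => hr.1.le)
        rw [this, ← mul_assoc, ← ENNReal.ofReal_mul (by norm_num)]
        refine le_mul_of_one_le_left zero_le ?_
        rw [ENNReal.one_le_ofReal]
        nlinarith [Real.pi_gt_three]
    _ ≤ _ := by
        refine lintegral_mono fun r => ?_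
        refine (mul_le_mul_right (circle_bound hF z r) _).trans (le_of_eq ?_)
        refine (lintegral_const_mul _ ?_).symm
        exact hm.comp (g := fun w => ‖F w‖ₑ ^ 2)
          (f := fun θ : ℝ => z + r * (Real.cos θ + Real.sin θ * Complex.I)) (by fun_prop)

/-- Point evaluations are bounded on the Fock space, locally uniformly. -/
theorem eval_bound {F : ℂ → ℂ} (hF : Differentiable ℂ F) {R : ℝ} {z : ℂ}
    (hz : ‖z‖ ≤ R) :
    ‖F z‖ₑ ^ 2 ≤ ENNReal.ofReal (Real.exp (π * (R + 1) ^ 2)) * ∫⁻ w, ‖F w‖ₑ ^ 2 ∂gaussian := by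
  have hm : Measurable fun w => ‖F w‖ₑ ^ 2 := (hF.continuous.measurable.enorm).pow_const 2
  refine (disc_bound hF z).trans ?_
  rw [gaussian, lintegral_withDensity_eq_lintegral_mul _ measurable_density hm,
    ← lintegral_const_mul _ (measurable_density.mul hm)]
  refine le_trans ?_ (setLIntegral_le_lintegral (Metric.closedBall z 1) _)
  refine setLIntegral_mono (measurable_const.mul (measurable_density.mul hm)) fun w hw => ?_
  simp only [Pi.mul_apply]
  rw [← mul_assoc, ← ENNReal.ofReal_mul (Real.exp_pos _).le, ← Real.exp_add]
  refine le_mul_of_one_le_left zero_le ?_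
  rw [ENNReal.one_le_ofReal, Real.one_le_exp_iff]
  have h1 : ‖w‖ ≤ R + 1 := by
    have := norm_le_norm_add_norm_sub' w z
    rw [Metric.mem_closedBall, dist_eq_norm] at hw
    linarith
  have h2 : ‖w‖ ^ 2 ≤ (R + 1) ^ 2 := by gcongr
  nlinarith [Real.pi_pos]

theorem eval_bound_norm {F : ℂ → ℂ} (hF : Differentiable ℂ F) (f : Lp ℂ 2 gaussian)
    (hf : f =ᵐ[gaussian] F) {R : ℝ} {z : ℂ} (hz : ‖z‖ ≤ R) :
    ‖F z‖ ^ 2 ≤ Real.exp (π * (R + 1) ^ 2) * ‖f‖ ^ 2 := by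
  have h := eval_bound hF hz
  have h1 : ∫⁻ w, ‖F w‖ₑ ^ 2 ∂gaussian = ‖f‖ₑ ^ 2 := by
    rw [Lp.enorm_def, eLpNorm_congr_ae hf,
      eLpNorm_eq_lintegral_rpow_enorm_toReal (by norm_num) (by norm_num)]
    simp only [ENNReal.toReal_ofNat, ENNReal.rpow_ofNat, one_div]
    rw [← ENNReal.rpow_natCast, ← ENNReal.rpow_mul]
    norm_num
  rw [h1, ← ofReal_norm, ← ofReal_norm, ← ENNReal.ofReal_pow (norm_nonneg _),
    ← ENNReal.ofReal_pow (norm_nonneg _), ← ENNReal.ofReal_mul (Real.exp_pos _).le] at h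
  exact (ENNReal.ofReal_le_ofReal_iff (by positivity)).1 h

/-- The Fock space is closed in `L²(ℂ, exp (-π |z|²) dA)`, so that the orthogonal projection onto
it exists. -/
theorem isClosed_fockSpace : IsClosed (fockSpace : Set (Lp ℂ 2 gaussian)) := by
  refine IsSeqClosed.isClosed fun f g hf hfg => ?_
  choose F hF hfF using hf
  have hdiff : ∀ m n, (f m - f n : Lp ℂ 2 gaussian) =ᵐ[gaussian] F m - F n := fun m n =>
    (Lp.coeFn_sub _ _).trans ((hfF m).sub (hfF n))
  have hcauchy : ∀ K : Set ℂ, IsCompact K → UniformCauchySeqOn F atTop K := by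
    intro K hK
    obtain ⟨R, hR⟩ : ∃ R : ℝ, ∀ z ∈ K, ‖z‖ ≤ R := hK.isBounded.exists_norm_le
    rw [Metric.uniformCauchySeqOn_iff]
    intro ε hε
    set C := Real.exp (π * (R + 1) ^ 2) with hC
    have hC0 : 0 < C := Real.exp_pos _
    obtain ⟨N, hN⟩ := Metric.cauchySeq_iff.1 hfg.cauchySeq (ε / √C) (by positivity)
    refine ⟨N, fun m hm n hn z hz => ?_⟩
    have h1 := eval_bound_norm ((hF m).sub (hF n)) _ (hdiff m n) (hR z hz)
    have h2 := hN m hm n hn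
    rw [dist_eq_norm] at h2 ⊢
    refine lt_of_pow_lt_pow_left₀ 2 hε.le ?_
    refine lt_of_le_of_lt h1 ?_
    rw [lt_div_iff₀ (by positivity)] at h2
    have h3 : (‖f m - f n‖ * √C) ^ 2 < ε ^ 2 := by gcongr
    rw [mul_pow, Real.sq_sqrt hC0.le] at h3
    linarith
  have hlim : ∀ z, ∃ l, Tendsto (fun n => F n z) atTop (𝓝 l) := fun z =>
    cauchySeq_tendsto_of_complete
      ((hcauchy {z} isCompact_singleton).cauchySeq rfl)
  choose L hL using hlim
  have hloc : TendstoLocallyUniformlyOn F L atTop Set.univ := by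
    rw [tendstoLocallyUniformlyOn_iff_forall_isCompact isOpen_univ]
    exact fun K _ hK => (hcauchy K hK).tendstoUniformlyOn_of_tendsto fun z _ => hL z
  refine ⟨L, ?_, ?_⟩
  · rw [← differentiableOn_univ]
    exact hloc.differentiableOn (Eventually.of_forall fun n => (hF n).differentiableOn)
      isOpen_univ
  · obtain ⟨ns, hns, hae⟩ := (tendstoInMeasure_of_tendsto_Lp hfg).exists_seq_tendsto_ae
    filter_upwards [hae, ae_all_iff.2 hfF] with z hz hz'
    simp only [hz'] at hz
    exact tendsto_nhds_unique hz ((hL z).comp hns.tendsto_atTop)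

instance : CompleteSpace fockSpace := isClosed_fockSpace.completeSpace_coe

end Closed

theorem memLp_indicator {Ω : Set ℂ} (hΩ : NullMeasurableSet Ω) (f : Lp ℂ 2 gaussian) :
    MemLp (Ω.indicator f) 2 gaussian :=
  (Lp.memLp f).of_le ((Lp.aestronglyMeasurable f).indicator₀ (hΩ.mono_ac gaussian_ac))
    (ae_of_all _ fun _ => norm_indicator_le_norm_self _ _)

/-- Multiplication by the characteristic function of a Lebesgue measurable set `Ω`, as an operator
on `L²(ℂ, exp (-π |z|²) dA)`. -/
def mulIndicator (Ω : Set ℂ) (hΩ : NullMeasurableSet Ω) :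
    Lp ℂ 2 gaussian →L[ℂ] Lp ℂ 2 gaussian :=
  LinearMap.mkContinuous
    { toFun := fun f => (memLp_indicator hΩ f).toLp (Ω.indicator f)
      map_add' := fun f g => by
        rw [← MemLp.toLp_add, MemLp.toLp_eq_toLp_iff]
        filter_upwards [Lp.coeFn_add f g] with z hz
        by_cases h : z ∈ Ω
        · simp only [Set.indicator_of_mem h, Pi.add_apply, hz]
        · simp only [Set.indicator_of_notMem h, Pi.add_apply, add_zero]
      map_smul' := fun c f => by
        rw [RingHom.id_apply, ← MemLp.toLp_const_smul, MemLp.toLp_eq_toLp_iff]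
        filter_upwards [Lp.coeFn_smul c f] with z hz
        by_cases h : z ∈ Ω
        · simp only [Set.indicator_of_mem h, Pi.smul_apply, hz]
        · simp only [Set.indicator_of_notMem h, Pi.smul_apply, smul_zero] }
    1 fun f => by
      rw [one_mul]
      refine Lp.norm_le_norm_of_ae_le ?_
      filter_upwards [(memLp_indicator hΩ f).coeFn_toLp] with z hz
      simp only [LinearMap.coe_mk, AddHom.coe_mk, hz]
      exact norm_indicator_le_norm_self _ _

/-- The Toeplitz (localization) operator `T_Ω = P χ_Ω` on the Fock space, where `P` is the
orthogonal projection of `L²(ℂ, exp (-π |z|²) dA)` onto the Fock space. -/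
def toeplitz (Ω : Set ℂ) (hΩ : NullMeasurableSet Ω) : fockSpace →L[ℂ] fockSpace :=
  fockSpace.orthogonalProjectionOnto ∘L mulIndicator Ω hΩ ∘L fockSpace.subtypeL

/-- The `k`-th eigenvalue (`k = 1, 2, …`) of a compact positive self-adjoint operator `T`, when the
eigenvalues are listed in decreasing order and repeated according to multiplicity: it is the
largest eigenvalue `t` of `T` such that the eigenvalues `s ≥ t` have total multiplicity at
least `k`. -/
def eigenvalueDecr {H : Type*} [NormedAddCommGroup H] [InnerProductSpace ℂ H] (T : H →L[ℂ] H)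
    (k : ℕ) : ℝ :=
  sSup {t : ℝ | Module.End.HasEigenvalue (T : H →ₗ[ℂ] H) (t : ℂ) ∧
    (k : Cardinal) ≤ Module.rank ℂ
      ↥(⨆ s ∈ Set.Ici t, Module.End.eigenspace (T : H →ₗ[ℂ] H) ((s : ℝ) : ℂ))}

/-- A Lebesgue measurable set of the form `{z | |z - w| ∈ E}` for some point `w` (the center of
symmetry) and some Lebesgue measurable `E ⊆ [0, ∞)`. -/
structure IsCircularlySymmetric (Ω : Set ℂ) : Prop where
  nullMeasurableSet : NullMeasurableSet Ω
  exists_eq : ∃ (w : ℂ) (E : Set ℝ), E ⊆ Set.Ici 0 ∧ NullMeasurableSet E ∧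
    Ω = {z | ‖z - w‖ ∈ E}

/-- A symmetric gauge function on `ℝⁿ`: a norm that depends only on the absolute values of the
coordinates and is invariant under permutations of the coordinates. -/
structure IsSymmetricGauge {n : ℕ} (f : (Fin n → ℝ) → ℝ) : Prop where
  nonneg : ∀ x, 0 ≤ f x
  eq_zero : ∀ x, f x = 0 → x = 0
  smul : ∀ (a : ℝ) (x), f (a • x) = |a| * f x
  add_le : ∀ x y, f (x + y) ≤ f x + f y
  abs : ∀ x, f x = f fun i => |x i|
  perm : ∀ (σ : Equiv.Perm (Fin n)) (x), f (x ∘ σ) = f x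

end Fock

end

noncomputable section

namespace Fock

open ComplexConjugate

/-! Rotation invariance about `w` makes the Toeplitz operator diagonal in the orthogonal basis `(z -
w) ^ k * exp (π w̄ z)`. In the variable `s = π |z - w| ^ 2` area becomes Lebesgue measure on the
half-line, so the diagonal entries are `∫ p_k dν`, where `p_k` is the Poisson weight and `ν`, the
radial distribution of the set, is dominated by Lebesgue measure and has mass `|Ω|`. For a disc, `ν`
is Lebesgue measure on `[0, |Ω|)`, and the entries are the Poisson tails, which decrease in `k`.

Everything reduces to a bathtub-type inequality (`sum_integral_poissonWeight_le`): for every set `K`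
of `m` indices, `∑ k ∈ K, ∫ p_k dν` is at most the sum of the first `m` tails at `a = ν(ℝ)`, that
is, `E min(N_a, m)`. No rearrangement of `ν` for a fixed `K` gives this, since `∑ k ∈ K, p_k` need
not be decreasing. It is instead a control problem. A Poisson process `N_t` runs while a budget `a`
is spent at rate `h ≤ 1`, and spending earns only while `N_t ∈ K`. With `m` elements of `K` not yet
passed and budget `a` left, the future gain is at most `E min(N_a, m)`; the expectation of this
bound along the process is a Lyapunov function (`sum_poissonWeight_drift_le`,
`intervalIntegral_sum_poissonWeight_le`).

Hence all partial sums of the ordered eigenvalues are dominated by those of the disc, and Ky Fan's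
principle (`le_of_partial_sums_le`) passes to symmetric gauge functions. -/

/-! ### Poisson weights and tails -/

/-- The Poisson weight `exp (-s) s ^ k / k!`. -/
def poissonWeight (k : ℕ) (s : ℝ) : ℝ := Real.exp (-s) * s ^ k / k.factorial

theorem poissonWeight_nonneg (k : ℕ) {s : ℝ} (hs : 0 ≤ s) : 0 ≤ poissonWeight k s := by
  unfold poissonWeight; positivity

theorem poissonWeight_pos (k : ℕ) {s : ℝ} (hs : 0 < s) : 0 < poissonWeight k s := by
  unfold poissonWeight; positivity

theorem continuous_poissonWeight (k : ℕ) : Continuous (poissonWeight k) := by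
  unfold poissonWeight; fun_prop

theorem poissonWeight_zero_zero : poissonWeight 0 0 = 1 := by simp [poissonWeight]

theorem poissonWeight_succ_zero (k : ℕ) : poissonWeight (k + 1) 0 = 0 := by simp [poissonWeight]

theorem hasDerivAt_poissonWeight_zero (s : ℝ) :
    HasDerivAt (poissonWeight 0) (-poissonWeight 0 s) s := by
  have h : HasDerivAt (fun x : ℝ => Real.exp (-x)) (Real.exp (-s) * -1) s :=
    (hasDerivAt_neg s).exp
  have e : poissonWeight 0 = fun x : ℝ => Real.exp (-x) := by
    ext x; simp [poissonWeight]
  rw [e]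
  simpa using h

theorem hasDerivAt_poissonWeight_succ (k : ℕ) (s : ℝ) :
    HasDerivAt (poissonWeight (k + 1)) (poissonWeight k s - poissonWeight (k + 1) s) s := by
  have h : HasDerivAt (fun x : ℝ => Real.exp (-x)) (Real.exp (-s) * -1) s :=
    (hasDerivAt_neg s).exp
  have h2 := (h.mul (hasDerivAt_pow (k + 1) s)).div_const ((k + 1).factorial : ℝ)
  refine h2.congr_deriv ?_
  have h3 : (k.factorial : ℝ) ≠ 0 := by positivity
  simp only [poissonWeight, Nat.factorial_succ]
  push_cast
  field_simp
  ring

/-- The Poisson tail `1 - ∑ j ≤ k, exp (-a) a ^ j / j!`. -/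
def poissonTail (k : ℕ) (a : ℝ) : ℝ := 1 - ∑ j ∈ Finset.range (k + 1), poissonWeight j a

theorem hasDerivAt_poissonTail (k : ℕ) (a : ℝ) :
    HasDerivAt (poissonTail k) (poissonWeight k a) a := by
  induction k with
  | zero =>
    have := (hasDerivAt_poissonWeight_zero a).const_sub 1
    have e : poissonTail 0 = fun x => 1 - poissonWeight 0 x := by
      ext x; simp [poissonTail]
    rw [e]
    simpa using this
  | succ k ih =>
    have := ih.sub (hasDerivAt_poissonWeight_succ k a)
    have e : poissonTail (k + 1) = poissonTail k - poissonWeight (k + 1) := by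
      ext x
      simp only [poissonTail, Finset.sum_range_succ _ (k + 1), Pi.sub_apply]
      ring
    rw [e]
    refine this.congr_deriv (by ring)

theorem poissonTail_zero (k : ℕ) : poissonTail k 0 = 0 := by
  simp [poissonTail, Finset.sum_range_succ', poissonWeight_zero_zero, poissonWeight_succ_zero]

theorem poissonTail_eq_integral (k : ℕ) (a : ℝ) :
    poissonTail k a = ∫ s in (0 : ℝ)..a, poissonWeight k s := by
  rw [intervalIntegral.integral_eq_sub_of_hasDerivAt (fun x _ => hasDerivAt_poissonTail k x)
    ((continuous_poissonWeight k).intervalIntegrable _ _), poissonTail_zero, sub_zero]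

theorem poissonTail_nonneg (k : ℕ) {a : ℝ} (ha : 0 ≤ a) : 0 ≤ poissonTail k a := by
  rw [poissonTail_eq_integral]
  exact intervalIntegral.integral_nonneg ha fun s hs => poissonWeight_nonneg k hs.1

theorem sum_poissonWeight_le_one (k : ℕ) {a : ℝ} (ha : 0 ≤ a) :
    ∑ j ∈ Finset.range (k + 1), poissonWeight j a ≤ 1 := by
  have := poissonTail_nonneg k ha
  unfold poissonTail at this
  linarith

theorem poissonWeight_le_one (k : ℕ) {a : ℝ} (ha : 0 ≤ a) : poissonWeight k a ≤ 1 :=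
  (Finset.single_le_sum (f := fun j => poissonWeight j a) (fun j _ => poissonWeight_nonneg j ha)
    (Finset.self_mem_range_succ k)).trans (sum_poissonWeight_le_one k ha)

theorem poissonTail_succ_le (k : ℕ) {a : ℝ} (ha : 0 ≤ a) :
    poissonTail (k + 1) a ≤ poissonTail k a := by
  have := poissonWeight_nonneg (k + 1) ha
  simp only [poissonTail, Finset.sum_range_succ _ (k + 1)]
  linarith

/-- The expectation `∑ k < m, P (N > k)` of `min N m` for a Poisson variable `N` of mean `a`. -/
def truncatedMean (m : ℕ) (a : ℝ) : ℝ := ∑ k ∈ Finset.range m, poissonTail k a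

theorem hasDerivAt_truncatedMean (m : ℕ) (a : ℝ) :
    HasDerivAt (truncatedMean m) (∑ k ∈ Finset.range m, poissonWeight k a) a :=
  HasDerivAt.fun_sum fun k _ => hasDerivAt_poissonTail k a

theorem truncatedMean_nonneg (m : ℕ) {a : ℝ} (ha : 0 ≤ a) : 0 ≤ truncatedMean m a :=
  Finset.sum_nonneg fun k _ => poissonTail_nonneg k ha

theorem truncatedMean_zero_left (a : ℝ) : truncatedMean 0 a = 0 := by simp [truncatedMean]

theorem continuous_truncatedMean (m : ℕ) : Continuous (truncatedMean m) :=
  continuous_iff_continuousAt.2 fun a => (hasDerivAt_truncatedMean m a).continuousAt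

/-! ### The extremal inequality for continuous densities -/

/-- Dynkin-type estimate for the function whose decay controls weighted Poisson sums. -/
theorem sum_poissonWeight_drift_le (K : Finset ℕ) {t a h : ℝ} (ht : 0 ≤ t) (ha : 0 ≤ a)
    (h0 : 0 ≤ h) (h1 : h ≤ 1) (n : ℕ) :
    poissonWeight n t * (truncatedMean (K.filter (n + 1 ≤ ·)).card a
        - truncatedMean (K.filter (n ≤ ·)).card a
        - h * ∑ k ∈ Finset.range (K.filter (n ≤ ·)).card, poissonWeight k a) ≤
      if n ∈ K then -(h * poissonWeight n t) else 0 := by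
  have hp := poissonWeight_nonneg n ht
  have hs : ∀ m, 0 ≤ ∑ k ∈ Finset.range m, poissonWeight k a := fun m =>
    Finset.sum_nonneg fun k _ => poissonWeight_nonneg k ha
  split_ifs with hn
  · have hc : (K.filter (n ≤ ·)).card = (K.filter (n + 1 ≤ ·)).card + 1 := by
      rw [← Finset.card_insert_of_notMem (a := n) (by simp)]
      congr 1
      ext x
      simp only [Finset.mem_filter, Finset.mem_insert]
      constructor
      · rintro ⟨hx, hxn⟩
        rcases hxn.eq_or_lt with h | h
        · exact Or.inl h.symm
        · exact Or.inr ⟨hx, h⟩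
      · rintro (rfl | ⟨hx, hxn⟩)
        · exact ⟨hn, le_rfl⟩
        · exact ⟨hx, by omega⟩
    rw [hc]
    set m := (K.filter (n + 1 ≤ ·)).card
    have hq := poissonTail_nonneg m ha
    have e : truncatedMean (m + 1) a = truncatedMean m a + poissonTail m a :=
      Finset.sum_range_succ _ _
    have e2 : ∑ k ∈ Finset.range (m + 1), poissonWeight k a = 1 - poissonTail m a := by
      unfold poissonTail; ring
    rw [e, e2]
    -- With `Q = poissonTail m a`, the bracket is `-Q - h (1 - Q) = -h - (1 - h) Q`, which is at
    -- most `-h` because `h ≤ 1`.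
    nlinarith [mul_nonneg hp (mul_nonneg (sub_nonneg.2 h1) hq)]
  · have hc : K.filter (n ≤ ·) = K.filter (n + 1 ≤ ·) := by
      ext x
      simp only [Finset.mem_filter]
      refine and_congr_right fun hx => ⟨fun h => ?_, fun h => by omega⟩
      rcases h.eq_or_lt with h | h
      · exact absurd (h ▸ hx) hn
      · exact h
    rw [hc]
    have := mul_nonneg h0 (hs (K.filter (n + 1 ≤ ·)).card)
    nlinarith

/-- Verification argument: `V t` is the expectation of `truncatedMean (m N_t) (a t)`, where `N_t` is
Poisson of mean `t`, `m n` counts the elements of `K` that are at least `n`, and `a t` is the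
unspent budget. The drift estimate bounds `V'` by minus the integrand, and `V T ≥ 0`, so the
integral is at most `V 0`. Only an upper bound `A` on the mass is required, so that one `A` serves
all `T`. -/
theorem intervalIntegral_sum_poissonWeight_le (K : Finset ℕ) {h : ℝ → ℝ} (hc : Continuous h)
    (h0 : ∀ s, 0 ≤ h s) (h1 : ∀ s, h s ≤ 1) {T A : ℝ} (hT : 0 ≤ T)
    (hA : ∫ s in (0 : ℝ)..T, h s ≤ A) :
    ∫ s in (0 : ℝ)..T, h s * ∑ k ∈ K, poissonWeight k s ≤ truncatedMean K.card A := by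
  obtain ⟨N, hN⟩ : ∃ N, ∀ k ∈ K, k < N := ⟨K.sup id + 1, fun k hk =>
    Nat.lt_succ_of_le (Finset.le_sup (f := id) hk)⟩
  set m : ℕ → ℕ := fun n => (K.filter (n ≤ ·)).card with hm
  have hmN : ∀ n, N ≤ n → m n = 0 := fun n hn => by
    simp only [hm, Finset.card_eq_zero, Finset.filter_eq_empty_iff]
    intro k hk
    have := hN k hk
    omega
  set a : ℝ → ℝ := fun t => A - ∫ s in (0 : ℝ)..t, h s with ha
  have hint : ∀ x y, IntervalIntegrable h volume x y := fun x y => hc.intervalIntegrable x y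
  have hda : ∀ t, HasDerivAt a (-h t) t := fun t =>
    (intervalIntegral.integral_hasDerivAt_right (hint 0 t)
      (hc.stronglyMeasurableAtFilter _ _) hc.continuousAt).const_sub A
  have ha0 : ∀ t ∈ Set.Icc 0 T, 0 ≤ a t := by
    rintro t ⟨ht0, htT⟩
    have h2 := intervalIntegral.integral_add_adjacent_intervals (hint 0 t) (hint t T)
    have h3 : 0 ≤ ∫ s in t..T, h s := intervalIntegral.integral_nonneg htT fun s _ => h0 s
    simp only [ha]
    linarith
  set V : ℝ → ℝ := fun t =>
    ∑ n ∈ Finset.range (N + 1), poissonWeight n t * truncatedMean (m n) (a t)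
    with hV
  set W : ℝ → ℝ := fun t => ∑ n ∈ Finset.range (N + 1), poissonWeight n t *
    (truncatedMean (m (n + 1)) (a t) - truncatedMean (m n) (a t)
      - h t * ∑ k ∈ Finset.range (m n), poissonWeight k (a t)) with hW
  have hdV : ∀ t, HasDerivAt V (W t) t := by
    intro t
    have hψ : ∀ n, HasDerivAt (fun t => truncatedMean (m n) (a t))
        ((∑ k ∈ Finset.range (m n), poissonWeight k (a t)) * -h t) t := fun n =>
      (hasDerivAt_truncatedMean (m n) (a t)).comp t (hda t)
    have e : V = fun t => (∑ n ∈ Finset.range N,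
        poissonWeight (n + 1) t * truncatedMean (m (n + 1)) (a t)) +
        poissonWeight 0 t * truncatedMean (m 0) (a t) := by
      ext t; exact Finset.sum_range_succ' _ _
    rw [e]
    refine ((HasDerivAt.fun_sum fun n _ => (hasDerivAt_poissonWeight_succ n t).mul
      (hψ (n + 1))).add ((hasDerivAt_poissonWeight_zero t).mul (hψ 0))).congr_deriv ?_
    -- Since `p_n' = p_{n-1} - p_n`, differentiation moves the truncated mean from index `n` to `n +
    -- 1` (summation by parts). The boundary term at `n = N` vanishes because `m (N + 1) = 0`.
    have e1 : W t = (∑ n ∈ Finset.range N, poissonWeight n t * truncatedMean (m (n + 1)) (a t)) -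
        ∑ n ∈ Finset.range (N + 1), poissonWeight n t * (truncatedMean (m n) (a t)
          + h t * ∑ k ∈ Finset.range (m n), poissonWeight k (a t)) := by
      have : ∑ n ∈ Finset.range N, poissonWeight n t * truncatedMean (m (n + 1)) (a t) =
          ∑ n ∈ Finset.range (N + 1), poissonWeight n t * truncatedMean (m (n + 1)) (a t) := by
        rw [Finset.sum_range_succ, hmN (N + 1) (by omega), truncatedMean_zero_left]
        ring
      rw [this, ← Finset.sum_sub_distrib]
      exact Finset.sum_congr rfl fun n _ => by ring
    rw [e1, Finset.sum_range_succ' _ N, ← sub_sub, ← Finset.sum_sub_distrib, sub_eq_add_neg]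
    congr 1
    · exact Finset.sum_congr rfl fun n _ => by ring
    · ring
  have hca : Continuous a := continuous_iff_continuousAt.2 fun t => (hda t).continuousAt
  have hcW : Continuous W := by
    refine continuous_finsetSum _ fun n _ => (continuous_poissonWeight n).mul ?_
    refine (((continuous_truncatedMean _).comp hca).sub ((continuous_truncatedMean _).comp hca)).sub
      (hc.mul ?_)
    exact continuous_finsetSum _ fun k _ => (continuous_poissonWeight k).comp hca
  have hFTC := intervalIntegral.integral_eq_sub_of_hasDerivAt (a := 0) (b := T) (fun t _ => hdV t)
    (hcW.intervalIntegrable _ _)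
  have hVT : 0 ≤ V T := Finset.sum_nonneg fun n _ => mul_nonneg (poissonWeight_nonneg n hT)
    (truncatedMean_nonneg _ (ha0 T ⟨hT, le_rfl⟩))
  -- At time `0` the process sits at `n = 0`, with all of `K` ahead and the full budget `A`.
  have hV0 : V 0 = truncatedMean K.card A := by
    simp only [hV]
    rw [Finset.sum_range_succ']
    simp [poissonWeight_zero_zero, poissonWeight_succ_zero, ha, hm]
  have hcS : Continuous fun s => h s * ∑ k ∈ K, poissonWeight k s :=
    hc.mul (continuous_finsetSum _ fun k _ => continuous_poissonWeight k)
  have hle : ∫ s in (0 : ℝ)..T, W s ≤ ∫ s in (0 : ℝ)..T, -(h s * ∑ k ∈ K, poissonWeight k s) := by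
    refine intervalIntegral.integral_mono_on hT (hcW.intervalIntegrable _ _)
      (hcS.neg.intervalIntegrable _ _) fun t ht => ?_
    refine (Finset.sum_le_sum fun n _ => sum_poissonWeight_drift_le K ht.1 (ha0 t ht) (h0 t)
      (h1 t) n).trans (le_of_eq ?_)
    rw [← Finset.sum_filter, Finset.sum_neg_distrib, Finset.mul_sum]
    congr 2
    ext k
    simp only [Finset.mem_filter, Finset.mem_range]
    exact ⟨fun h => h.2, fun h => ⟨by have := hN k h; omega, h⟩⟩
  rw [intervalIntegral.integral_neg] at hle
  linarith


/-! ### Ky Fan dominance -/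

/-- Abel summation: antitone nonnegative weights preserve inequalities between partial sums. -/
theorem sum_mul_le_sum_mul_of_partial_sums_le {n : ℕ} {a x y : ℕ → ℝ}
    (ha : Antitone a) (ha0 : ∀ i, 0 ≤ a i)
    (hxy : ∀ j ≤ n, ∑ i ∈ Finset.range j, x i ≤ ∑ i ∈ Finset.range j, y i) :
    ∑ i ∈ Finset.range n, a i * x i ≤ ∑ i ∈ Finset.range n, a i * y i := by
  have key : ∀ j ≤ n, a j * (∑ i ∈ Finset.range j, (y i - x i)) ≤
      ∑ i ∈ Finset.range j, a i * (y i - x i) := by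
    intro j
    induction j with
    | zero => simp
    | succ j ih =>
      intro hj
      have h1 := ih (by omega)
      have h2 := hxy (j + 1) hj
      have h3 := hxy j (by omega)
      rw [Finset.sum_range_succ _ j, Finset.sum_range_succ _ j]
      have h4 : a (j + 1) ≤ a j := ha (Nat.le_succ j)
      have h5 : 0 ≤ ∑ i ∈ Finset.range (j + 1), (y i - x i) := by
        rw [Finset.sum_sub_distrib]; linarith
      rw [Finset.sum_range_succ] at h5
      nlinarith [mul_nonneg (sub_nonneg.2 h4) h5]
  have h := key n le_rfl
  have h2 : 0 ≤ ∑ i ∈ Finset.range n, (y i - x i) := by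
    rw [Finset.sum_sub_distrib]; linarith [hxy n le_rfl]
  have h3 := (mul_nonneg (ha0 n) h2).trans h
  simp only [mul_sub, Finset.sum_sub_distrib] at h3
  linarith

namespace IsSymmetricGauge

variable {n : ℕ} {f : (Fin n → ℝ) → ℝ}

theorem convexOn (hf : IsSymmetricGauge f) : ConvexOn ℝ Set.univ f := by
  refine ⟨convex_univ, fun x _ y _ a b ha hb _ => ?_⟩
  refine (hf.add_le _ _).trans ?_
  rw [hf.smul, hf.smul, abs_of_nonneg ha, abs_of_nonneg hb, smul_eq_mul, smul_eq_mul]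

theorem signed_perm (hf : IsSymmetricGauge f) (y : Fin n → ℝ) (σ : Equiv.Perm (Fin n))
    (ε : Fin n → SignType) (hε : ∀ i, ε i ≠ 0) : f (fun i => (ε i : ℝ) * y (σ i)) = f y := by
  rw [← hf.perm σ y, hf.abs, hf.abs (y ∘ σ)]
  congr 1
  ext i
  rw [abs_mul]
  have : |((ε i : SignType) : ℝ)| = 1 := by
    have := hε i
    revert this
    cases ε i <;> simp
  rw [this, one_mul, Function.comp_apply]

/-- Ky Fan's dominance principle for symmetric gauge functions. -/
theorem le_of_partial_sums_le (hf : IsSymmetricGauge f) {x y : ℕ → ℝ}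
    (hx : Antitone x) (hx0 : ∀ i, 0 ≤ x i)
    (hxy : ∀ j ≤ n, ∑ i ∈ Finset.range j, x i ≤ ∑ i ∈ Finset.range j, y i) :
    f (fun i : Fin n => x i) ≤ f (fun i : Fin n => y i) := by
  set X : Fin n → ℝ := fun i => x i
  set Y : Fin n → ℝ := fun i => y i
  set S : Set (Fin n → ℝ) := {z | ∃ (σ : Equiv.Perm (Fin n)) (ε : Fin n → SignType),
    (∀ i, ε i ≠ 0) ∧ z = fun i => (ε i : ℝ) * Y (σ i)} with hS
  have hSfin : S.Finite := by
    refine (Set.finite_range fun p : Equiv.Perm (Fin n) × (Fin n → SignType) =>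
      (fun i => (p.2 i : ℝ) * Y (p.1 i) : Fin n → ℝ)).subset ?_
    rintro z ⟨σ, ε, -, rfl⟩
    exact ⟨(σ, ε), rfl⟩
  -- A functional `c` separating `X` from `S` cannot exist: by rearrangement `c · X` is at most the
  -- pairing of `X` with the decreasing rearrangement of `|c|`; Abel summation replaces `X` by `Y`;
  -- and the result is the value of `c` at a signed permutation of `Y`.
  have hmem : X ∈ convexHull ℝ S := by
    by_contra hX
    obtain ⟨φ, u, hu, hu'⟩ := geometric_hahn_banach_closed_point (convex_convexHull ℝ S)
      (hSfin.isCompact_convexHull ℝ).isClosed hX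
    set c : Fin n → ℝ := fun i => φ (Pi.single i 1) with hc
    have hφ : ∀ z, φ z = ∑ i, c i * z i := fun z => by
      conv_lhs => rw [pi_eq_sum_univ' (R := ℝ) z]
      rw [map_sum]
      refine Finset.sum_congr rfl fun i _ => ?_
      rw [map_smul, smul_eq_mul, mul_comm]
    obtain ⟨τ, hτ⟩ : ∃ τ : Equiv.Perm (Fin n), Antitone fun i => |c (τ i)| := by
      refine ⟨Tuple.sort (fun i => -|c i|), fun i j hij => ?_⟩
      have := Tuple.monotone_sort (fun i => -|c i|) hij
      simpa using this
    set ε : Fin n → SignType := fun i => if 0 ≤ c i then 1 else -1 with hε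
    have hεc : ∀ i, c i * (ε i : ℝ) = |c i| := fun i => by
      simp only [hε]
      split_ifs with h
      · simp [abs_of_nonneg h]
      · simp [abs_of_neg (not_le.1 h)]
    have hz : (fun i => (ε i : ℝ) * Y (τ.symm i)) ∈ S := by
      refine ⟨τ.symm, ε, fun i => ?_, rfl⟩
      simp only [hε]
      split_ifs <;> decide
    have h1 := hu _ (subset_convexHull ℝ S hz)
    rw [hφ] at h1 hu'
    have e1 : ∑ i, c i * ((ε i : ℝ) * Y (τ.symm i)) = ∑ i, |c (τ i)| * Y i := by
      rw [← Equiv.sum_comp τ]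
      refine Finset.sum_congr rfl fun i _ => ?_
      rw [← mul_assoc, hεc, Equiv.symm_apply_apply]
    have h2 : ∑ i, c i * X i ≤ ∑ i, |c (τ i)| * X i := by
      have h3 : ∑ i, c i * X i ≤ ∑ i, |c i| * X i :=
        Finset.sum_le_sum fun i _ => mul_le_mul_of_nonneg_right (le_abs_self _) (hx0 _)
      have hmono : Monovary (fun i => |c (τ i)|) X := by
        have hX' : Antitone X := fun i j hij => hx hij
        exact hτ.monovary hX'
      have h4 := hmono.sum_comp_perm_mul_le_sum_mul (σ := τ.symm)
      simp only [Equiv.apply_symm_apply] at h4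
      exact h3.trans h4
    have h5 : ∑ i, |c (τ i)| * X i ≤ ∑ i, |c (τ i)| * Y i := by
      set a : ℕ → ℝ := fun i => if h : i < n then |c (τ ⟨i, h⟩)| else 0 with ha
      have haa : Antitone a := by
        intro i j hij
        simp only [ha]
        split_ifs with h h' h'
        · exact hτ (by simpa using hij)
        · omega
        · exact abs_nonneg _
        · exact le_rfl
      have ha0 : ∀ i, 0 ≤ a i := fun i => by
        simp only [ha]; split_ifs
        · exact abs_nonneg _
        · exact le_rfl
      have := sum_mul_le_sum_mul_of_partial_sums_le haa ha0 hxy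
      rw [Finset.sum_range, Finset.sum_range] at this
      simpa [ha] using this
    rw [e1] at h1
    linarith
  -- A convex function on the hull is bounded at `X` by its value at some point of `S`, and `f`
  -- equals `f Y` throughout `S`.
  obtain ⟨z, ⟨σ, ε, hε, rfl⟩, hz⟩ := (hf.convexOn.subset (Set.subset_univ _)
    (convex_convexHull ℝ S)).exists_ge_of_mem_convexHull (subset_convexHull ℝ S) hmem
  rwa [hf.signed_perm Y σ ε hε] at hz

end IsSymmetricGauge


/-! ### The extremal inequality for dominated measures -/

theorem integrable_poissonWeight {ν : Measure ℝ} [IsFiniteMeasure ν]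
    (hν : ν ≤ volume.restrict (Set.Ici 0)) (k : ℕ) : Integrable (poissonWeight k) ν := by
  refine Integrable.of_bound (continuous_poissonWeight k).aestronglyMeasurable 1 ?_
  have h0 : ∀ᵐ s ∂ν, 0 ≤ s :=
    (Measure.absolutelyContinuous_of_le hν) (ae_restrict_mem measurableSet_Ici)
  filter_upwards [h0] with s hs
  rw [Real.norm_of_nonneg (poissonWeight_nonneg k hs)]
  exact poissonWeight_le_one k hs

theorem setIntegral_Ici_sum_poissonWeight_le (K : Finset ℕ) {h : ℝ → ℝ} (hc : Continuous h)
    (h0 : ∀ s, 0 ≤ h s) (h1 : ∀ s, h s ≤ 1) (hi : IntegrableOn h (Set.Ici 0))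
    (hib : IntegrableOn (fun s => h s * ∑ k ∈ K, poissonWeight k s) (Set.Ici 0)) :
    ∫ s in Set.Ici 0, h s * ∑ k ∈ K, poissonWeight k s ≤
      truncatedMean K.card (∫ s in Set.Ici 0, h s) := by
  rw [integral_Ici_eq_integral_Ioi]
  refine le_of_tendsto (intervalIntegral_tendsto_integral_Ioi 0
    (hib.mono_set Set.Ioi_subset_Ici_self) tendsto_id) ?_
  filter_upwards [eventually_ge_atTop 0] with T hT
  refine intervalIntegral_sum_poissonWeight_le K hc h0 h1 hT ?_
  rw [id, intervalIntegral.integral_of_le hT]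
  refine setIntegral_mono_set hi (ae_of_all _ h0) (LE.le.eventuallyLE ?_)
  exact fun s hs => hs.1.le

/-- Among the measures of given mass that are dominated by the Lebesgue measure of the half-line,
sums of `m` Poisson weights have the largest integral for the first `m` weights and an initial
interval. -/
theorem sum_integral_poissonWeight_le {ν : Measure ℝ} [IsFiniteMeasure ν]
    (hν : ν ≤ volume.restrict (Set.Ici 0)) (K : Finset ℕ) :
    ∑ k ∈ K, ∫ s, poissonWeight k s ∂ν ≤ truncatedMean K.card (ν.real Set.univ) := by
  set μ : Measure ℝ := volume.restrict (Set.Ici 0) with hμ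
  have hac : ν ≪ μ := Measure.absolutelyContinuous_of_le hν
  set b : ℝ → ℝ := fun s => ∑ k ∈ K, poissonWeight k s with hb
  have hbc : Continuous b := continuous_finsetSum _ fun k _ => continuous_poissonWeight k
  have hb0 : ∀ᵐ s ∂μ, ‖b s‖ ≤ K.card := by
    filter_upwards [ae_restrict_mem measurableSet_Ici] with s hs
    rw [Real.norm_of_nonneg (Finset.sum_nonneg fun k _ => poissonWeight_nonneg k hs)]
    refine (Finset.sum_le_card_nsmul K _ 1 fun k _ => poissonWeight_le_one k hs).trans ?_
    simp
  set h : ℝ → ℝ := fun s => (ν.rnDeriv μ s).toReal with hh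
  have hhi : Integrable h μ := Measure.integrable_toReal_rnDeriv
  have hh1 : ∀ᵐ s ∂μ, h s ≤ 1 := by
    filter_upwards [Measure.rnDeriv_le_one_of_le hν] with s hs
    exact ENNReal.toReal_le_of_le_ofReal zero_le_one (by simpa using hs)
  have hh0 : ∀ s, 0 ≤ h s := fun s => ENNReal.toReal_nonneg
  have hsum : ∑ k ∈ K, ∫ s, poissonWeight k s ∂ν = ∫ s, h s * b s ∂μ := by
    rw [← integral_finsetSum _ fun k _ => integrable_poissonWeight hν k]
    exact (integral_rnDeriv_smul hac).symm
  have hmass : ν.real Set.univ = ∫ s, h s ∂μ := by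
    have := integral_rnDeriv_smul (f := fun _ : ℝ => (1 : ℝ)) hac
    simpa using this.symm
  have hex : ∀ n : ℕ, ∃ g : ℝ → ℝ, Continuous g ∧ (∀ s, 0 ≤ g s) ∧ (∀ s, g s ≤ 1) ∧
      Integrable g μ ∧ ∫ s, ‖h s - g s‖ ∂μ ≤ 1 / ((n : ℝ) + 1) := by
    intro n
    obtain ⟨g, -, hg, hgc, hgi⟩ := hhi.exists_hasCompactSupport_integral_sub_le
      (ε := 1 / ((n : ℝ) + 1)) (by positivity)
    -- Clipping the continuous approximant to `[0, 1]` only brings it closer to `h`, whose values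
    -- lie in `[0, 1]` almost everywhere.
    have hi : Integrable (fun s => max 0 (min 1 (g s))) μ := by
      refine hgi.mono (by fun_prop) (ae_of_all _ fun s => ?_)
      rw [Real.norm_of_nonneg (le_max_left _ _), Real.norm_eq_abs]
      exact max_le (abs_nonneg _) ((min_le_right _ _).trans (le_abs_self _))
    refine ⟨fun s => max 0 (min 1 (g s)), by fun_prop, fun s => le_max_left _ _,
      fun s => max_le zero_le_one (min_le_left _ _), hi, le_trans ?_ hg⟩
    refine integral_mono_ae (hhi.sub hi).norm (hhi.sub hgi).norm ?_
    filter_upwards [hh1] with s hs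
    have h0 := hh0 s
    simp only [Real.norm_eq_abs]
    rcases le_total (g s) 0 with h2 | h2
    · rw [min_eq_right (by linarith), max_eq_left h2, abs_of_nonneg (by linarith),
        abs_of_nonneg (by linarith)]
      linarith
    · rcases le_total (g s) 1 with h3 | h3
      · rw [min_eq_right h3, max_eq_right h2]
      · rw [min_eq_left h3, max_eq_right zero_le_one, abs_of_nonpos (by linarith),
          abs_of_nonpos (by linarith)]
        linarith
  choose g hgc hg0 hg1 hgi hg using hex
  have hbi : ∀ {u : ℝ → ℝ}, Integrable u μ → Integrable (fun s => u s * b s) μ := fun hu =>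
    hu.mul_bdd hbc.aestronglyMeasurable hb0
  have hlim0 : Tendsto (fun n : ℕ => 1 / ((n : ℝ) + 1)) atTop (𝓝 0) :=
    tendsto_one_div_add_atTop_nhds_zero_nat
  have hlimA : Tendsto (fun n => ∫ s, g n s ∂μ) atTop (𝓝 (∫ s, h s ∂μ)) := by
    rw [tendsto_iff_norm_sub_tendsto_zero]
    refine squeeze_zero (fun n => norm_nonneg _) (fun n => ?_) hlim0
    rw [norm_sub_rev, ← integral_sub hhi (hgi n)]
    exact (norm_integral_le_integral_norm _).trans (hg n)
  have hlimB : Tendsto (fun n => ∫ s, g n s * b s ∂μ) atTop (𝓝 (∫ s, h s * b s ∂μ)) := by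
    rw [tendsto_iff_norm_sub_tendsto_zero]
    refine squeeze_zero (fun n => norm_nonneg _) (fun n => ?_)
      (by simpa only [mul_zero] using hlim0.const_mul (K.card : ℝ))
    rw [norm_sub_rev, ← integral_sub (hbi hhi) (hbi (hgi n))]
    refine (norm_integral_le_integral_norm _).trans ?_
    refine le_trans ?_ (mul_le_mul_of_nonneg_left (hg n) (Nat.cast_nonneg _))
    rw [← integral_const_mul]
    refine integral_mono_ae ((hbi hhi).sub (hbi (hgi n))).norm
      ((hhi.sub (hgi n)).norm.const_mul _) ?_
    filter_upwards [hb0] with s hs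
    rw [← sub_mul, norm_mul, mul_comm]
    exact mul_le_mul_of_nonneg_right hs (norm_nonneg _)
  rw [hsum, hmass]
  refine le_of_tendsto_of_tendsto' hlimB
    (((continuous_truncatedMean K.card).tendsto _).comp hlimA) fun n => ?_
  exact setIntegral_Ici_sum_poissonWeight_le K (hgc n) (hg0 n) (hg1 n) (hgi n) (hbi (hgi n))


/-! ### Ordered eigenvalues of diagonal operators -/

/-- `T` is diagonal with entries `μ` in the orthogonal basis `F`. -/
structure IsDiagonalIn {H : Type*} [NormedAddCommGroup H] [InnerProductSpace ℂ H] (T : H →L[ℂ] H)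
    (F : ℕ → H) (μ : ℕ → ℝ) : Prop where
  ne_zero : ∀ k, F k ≠ 0
  orthogonal : ∀ k l, k ≠ l → inner ℂ (F k) (F l) = 0
  complete : ∀ f, (∀ k, inner ℂ (F k) f = 0) → f = 0
  inner_apply : ∀ k f, inner ℂ (F k) (T f) = (μ k : ℂ) * inner ℂ (F k) f

/-- The eigenvalues of `T` whose upper spectral subspace has dimension at least `k`. -/
def eigenvalueCandidates {H : Type*} [NormedAddCommGroup H] [InnerProductSpace ℂ H] (T : H →L[ℂ] H)
    (k : ℕ) : Set ℝ :=
  {t : ℝ | Module.End.HasEigenvalue (T : H →ₗ[ℂ] H) (t : ℂ) ∧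
    (k : Cardinal) ≤ Module.rank ℂ
      ↥(⨆ s ∈ Set.Ici t, Module.End.eigenspace (T : H →ₗ[ℂ] H) ((s : ℝ) : ℂ))}

theorem eigenvalueDecr_eq {H : Type*} [NormedAddCommGroup H] [InnerProductSpace ℂ H]
    (T : H →L[ℂ] H) (k : ℕ) : eigenvalueDecr T k = sSup (eigenvalueCandidates T k) := rfl

theorem eigenvalueCandidates_antitone {H : Type*} [NormedAddCommGroup H] [InnerProductSpace ℂ H]
    (T : H →L[ℂ] H) : Antitone (eigenvalueCandidates T) := fun k l hkl _ ht =>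
  ⟨ht.1, le_trans (by exact_mod_cast hkl) ht.2⟩

namespace IsDiagonalIn

variable {H : Type*} [NormedAddCommGroup H] [InnerProductSpace ℂ H] {T : H →L[ℂ] H}
  {F : ℕ → H} {μ : ℕ → ℝ}

theorem inner_eq_zero_of_mem_eigenspace (hT : IsDiagonalIn T F μ) {t : ℝ} {f : H}
    (hf : f ∈ Module.End.eigenspace (T : H →ₗ[ℂ] H) (t : ℂ)) {k : ℕ} (hk : μ k ≠ t) :
    inner ℂ (F k) f = 0 := by
  rw [Module.End.mem_eigenspace_iff] at hf
  have h1 := hT.inner_apply k f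
  have h2 : T f = (t : ℂ) • f := hf
  rw [h2, inner_smul_right] at h1
  by_contra h
  exact hk (by exact_mod_cast (mul_right_cancel₀ h h1).symm)

theorem exists_eq_of_hasEigenvalue (hT : IsDiagonalIn T F μ) {t : ℝ}
    (ht : Module.End.HasEigenvalue (T : H →ₗ[ℂ] H) (t : ℂ)) : ∃ k, μ k = t := by
  obtain ⟨f, hf, hf0⟩ := ht.exists_hasEigenvector
  by_contra! h
  exact hf0 (hT.complete f fun k => hT.inner_eq_zero_of_mem_eigenspace hf (h k))

theorem apply_basis (hT : IsDiagonalIn T F μ) (k : ℕ) : T (F k) = (μ k : ℂ) • F k := by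
  rw [← sub_eq_zero]
  refine hT.complete _ fun l => ?_
  rw [inner_sub_right, hT.inner_apply, inner_smul_right]
  rcases eq_or_ne l k with rfl | h
  · ring
  · rw [hT.orthogonal l k h]; ring

theorem hasEigenvalue (hT : IsDiagonalIn T F μ) (k : ℕ) :
    Module.End.HasEigenvalue (T : H →ₗ[ℂ] H) (μ k : ℂ) :=
  Module.End.hasEigenvalue_of_hasEigenvector
    ⟨Module.End.mem_eigenspace_iff.2 (hT.apply_basis k), hT.ne_zero k⟩

/-- The upper spectral subspace is orthogonal to every `F k` with `k ∉ s`, so by completeness its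
vectors are determined by their `s.card` coefficients in `s`. -/
theorem le_card_of_mem_candidates (hT : IsDiagonalIn T F μ) {t : ℝ} {n : ℕ}
    (ht : t ∈ eigenvalueCandidates T n) (s : Finset ℕ) (hs : ∀ k, t ≤ μ k → k ∈ s) :
    n ≤ s.card := by
  set U : Submodule ℂ H :=
    ⨆ s ∈ Set.Ici t, Module.End.eigenspace (T : H →ₗ[ℂ] H) ((s : ℝ) : ℂ) with hU
  have hle : ∀ k ∉ s, U ≤ LinearMap.ker (innerSL ℂ (F k) : H →ₗ[ℂ] ℂ) := by
    intro k hk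
    refine iSup₂_le fun r hr f hf => ?_
    rw [LinearMap.mem_ker]
    refine hT.inner_eq_zero_of_mem_eigenspace hf fun h => hk (hs k ?_)
    rw [h]; exact hr
  set Φ : U →ₗ[ℂ] (s → ℂ) :=
    (LinearMap.pi fun k : s => (innerSL ℂ (F k) : H →ₗ[ℂ] ℂ)) ∘ₗ U.subtype with hΦ
  have hinj : Function.Injective Φ := by
    rw [injective_iff_map_eq_zero]
    intro f hf
    refine Subtype.ext (hT.complete f fun k => ?_)
    by_cases hk : k ∈ s
    · exact congrFun hf ⟨k, hk⟩
    · exact hle k hk f.2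
  have h1 := LinearMap.lift_rank_le_of_injective Φ hinj
  have h2 : (n : Cardinal) ≤ Module.rank ℂ U := ht.2
  have h3 := Cardinal.lift_le.{0}.2 h2
  have h4 := h3.trans h1
  rw [rank_fun'] at h4
  simpa using h4

theorem mem_candidates (hT : IsDiagonalIn T F μ) (hμ : Antitone μ) (i : ℕ) :
    μ i ∈ eigenvalueCandidates T (i + 1) := by
  refine ⟨hT.hasEigenvalue i, ?_⟩
  set U : Submodule ℂ H :=
    ⨆ s ∈ Set.Ici (μ i), Module.End.eigenspace (T : H →ₗ[ℂ] H) ((s : ℝ) : ℂ) with hU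
  have hmem : ∀ k : Fin (i + 1), F k ∈ U := fun k =>
    (le_iSup₂_of_le (f := fun (s : ℝ) (_ : s ∈ Set.Ici (μ i)) =>
      Module.End.eigenspace (T : H →ₗ[ℂ] H) (s : ℂ)) (μ k)
      (hμ (Nat.lt_succ_iff.1 k.2)) le_rfl) (Module.End.mem_eigenspace_iff.2 (hT.apply_basis k))
  have hli : LinearIndependent ℂ fun k : Fin (i + 1) => F k :=
    linearIndependent_of_ne_zero_of_inner_eq_zero (fun k => hT.ne_zero k) fun k l hkl =>
      hT.orthogonal k l (Fin.val_ne_of_ne hkl)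
  have hli' : LinearIndependent ℂ fun k : Fin (i + 1) => (⟨F k, hmem k⟩ : U) :=
    LinearIndependent.of_comp U.subtype hli
  have := hli'.cardinal_lift_le_rank
  simpa using this

theorem bddAbove_candidates (hT : IsDiagonalIn T F μ) (hμ : BddAbove (Set.range μ)) (n : ℕ) :
    BddAbove (eigenvalueCandidates T n) :=
  hμ.mono fun _ ht => hT.exists_eq_of_hasEigenvalue ht.1

theorem le_eigenvalueDecr (hT : IsDiagonalIn T F μ) (hμ : Antitone μ) (i : ℕ) :
    μ i ≤ eigenvalueDecr T (i + 1) :=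
  le_csSup (hT.bddAbove_candidates ⟨μ 0, by rintro _ ⟨k, rfl⟩; exact hμ (Nat.zero_le k)⟩ _)
    (hT.mem_candidates hμ i)

theorem eigenvalueDecr_nonneg (hT : IsDiagonalIn T F μ) (hμ : ∀ k, 0 < μ k) (n : ℕ) :
    0 ≤ eigenvalueDecr T n :=
  Real.sSup_nonneg fun t ht => by
    obtain ⟨k, rfl⟩ := hT.exists_eq_of_hasEigenvalue ht.1
    exact (hμ k).le

theorem eigenvalueDecr_antitone (hT : IsDiagonalIn T F μ) (hμ : ∀ k, 0 < μ k)
    (hb : BddAbove (Set.range μ)) : Antitone (eigenvalueDecr T) := by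
  intro k l hkl
  rcases (eigenvalueCandidates T l).eq_empty_or_nonempty with h | h
  · rw [eigenvalueDecr_eq T l, h, Real.sSup_empty]
    exact hT.eigenvalueDecr_nonneg hμ k
  · exact csSup_le_csSup (hT.bddAbove_candidates hb k) h (eigenvalueCandidates_antitone T hkl)

/-- The supremum is attained: `μ` tends to `0`, so only finitely many candidates exceed a given
positive one. -/
theorem eigenvalueDecr_mem (hT : IsDiagonalIn T F μ) (hμ : ∀ k, 0 < μ k)
    (hlim : Tendsto μ atTop (𝓝 0)) {n : ℕ} (hn : (eigenvalueCandidates T n).Nonempty) :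
    eigenvalueDecr T n ∈ eigenvalueCandidates T n := by
  obtain ⟨t, ht⟩ := hn
  have ht0 : 0 < t := by
    obtain ⟨k, rfl⟩ := hT.exists_eq_of_hasEigenvalue ht.1
    exact hμ k
  have hfin : {k | t ≤ μ k}.Finite := by
    have := (hlim.eventually (gt_mem_nhds ht0))
    rw [← Nat.cofinite_eq_atTop] at this
    simpa [Filter.Eventually, Filter.mem_cofinite, Set.compl_ofPred] using this
  have hfin2 : (eigenvalueCandidates T n ∩ Set.Ici t).Finite := by
    refine (hfin.image μ).subset ?_
    rintro s ⟨hs, hts⟩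
    obtain ⟨k, rfl⟩ := hT.exists_eq_of_hasEigenvalue hs.1
    exact ⟨k, hts, rfl⟩
  obtain ⟨s, hs, hmax⟩ := Set.exists_max_image _ id hfin2 ⟨t, ht, le_refl t⟩
  have hg : IsGreatest (eigenvalueCandidates T n) s := by
    refine ⟨hs.1, fun r hr => ?_⟩
    rcases le_total t r with h | h
    · exact hmax r ⟨hr, h⟩
    · exact h.trans hs.2
  rw [eigenvalueDecr_eq]
  exact hg.csSup_mem

/-- Sums of the largest eigenvalues are dominated by sums of diagonal entries. -/
theorem exists_sum_eigenvalueDecr_le (hT : IsDiagonalIn T F μ) (hμ : ∀ k, 0 < μ k)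
    (hlim : Tendsto μ atTop (𝓝 0)) (n : ℕ) : ∃ K : Finset ℕ, K.card = n ∧
      ∑ i ∈ Finset.range n, eigenvalueDecr T (i + 1) ≤ ∑ k ∈ K, μ k := by
  induction n with
  | zero => exact ⟨∅, rfl, by simp⟩
  | succ n ih =>
    obtain ⟨K, hK, hsum⟩ := ih
    -- Greedy choice: if every index with `μ k ≥ λ_{n+1}` lay in `K`, the spectral subspace above
    -- `λ_{n+1}` would have dimension at most `n`. With no candidates, `sSup ∅ = 0` and any new
    -- index works.
    obtain ⟨k, hk, hle⟩ : ∃ k ∉ K, eigenvalueDecr T (n + 1) ≤ μ k := by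
      rcases (eigenvalueCandidates T (n + 1)).eq_empty_or_nonempty with h | h
      · obtain ⟨k, hk⟩ := Infinite.exists_notMem_finset K
        exact ⟨k, hk, by rw [eigenvalueDecr_eq, h, Real.sSup_empty]; exact (hμ k).le⟩
      · by_contra! hcon
        have := hT.le_card_of_mem_candidates (hT.eigenvalueDecr_mem hμ hlim h) K
          fun k hk => by_contra fun hkK => absurd (hcon k hkK) (not_lt.2 hk)
        omega
    refine ⟨insert k K, by rw [Finset.card_insert_of_notMem hk, hK], ?_⟩
    rw [Finset.sum_range_succ, Finset.sum_insert hk, add_comm]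
    exact add_le_add hle hsum

end IsDiagonalIn


/-! ### Radial distribution of area -/

theorem volume_pi_mul_norm_sq_le (b : ℝ) :
    volume {z : ℂ | π * ‖z‖ ^ 2 ≤ b} = ENNReal.ofReal b := by
  rcases lt_or_ge b 0 with hb | hb
  · rw [ENNReal.ofReal_of_nonpos hb.le]
    convert! measure_empty (μ := (volume : Measure ℂ))
    ext z
    simp only [Set.mem_ofPred_eq, Set.mem_empty_iff_false, iff_false, not_le]
    exact hb.trans_le (by positivity)
  · have e : {z : ℂ | π * ‖z‖ ^ 2 ≤ b} = Metric.closedBall 0 (√(b / π)) := by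
      ext z
      rw [mem_closedBall_zero_iff, Real.le_sqrt (norm_nonneg _) (by positivity),
        le_div_iff₀' pi_pos]
      rfl
    rw [e, Complex.volume_closedBall, ← ENNReal.ofReal_pow (Real.sqrt_nonneg _),
      Real.sq_sqrt (by positivity)]
    have : (NNReal.pi : ENNReal) = ENNReal.ofReal π := by
      rw [ENNReal.ofReal, ← NNReal.coe_real_pi, Real.toNNReal_coe]
    rw [this, ← ENNReal.ofReal_mul (by positivity), div_mul_cancel₀ _ pi_ne_zero]

theorem measurable_pi_mul_norm_sq : Measurable fun z : ℂ => π * ‖z‖ ^ 2 := by fun_prop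

/-- In the variable `s = π |z| ^ 2` the area measure becomes the Lebesgue measure. -/
theorem map_pi_mul_norm_sq :
    (volume : Measure ℂ).map (fun z => π * ‖z‖ ^ 2) = volume.restrict (Set.Ici 0) := by
  have h1 : ∀ b, (volume : Measure ℂ).map (fun z => π * ‖z‖ ^ 2) (Set.Iic b) =
      ENNReal.ofReal b := fun b => by
    rw [Measure.map_apply measurable_pi_mul_norm_sq measurableSet_Iic]
    exact volume_pi_mul_norm_sq_le b
  have h2 : ∀ b : ℝ, volume.restrict (Set.Ici 0) (Set.Iic b) = ENNReal.ofReal b := fun b => by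
    rw [Measure.restrict_apply measurableSet_Iic, Set.inter_comm, Set.Ici_inter_Iic,
      Real.volume_Icc, sub_zero]
  refine Measure.ext_of_Ioc' _ _ (fun a b hab => ?_) fun a b hab => ?_
  · refine ((measure_mono Set.Ioc_subset_Iic_self).trans_lt ?_).ne
    rw [h1]; exact ENNReal.ofReal_lt_top
  · rw [← Set.Iic_sdiff_Iic, measure_sdiff (Set.Iic_subset_Iic.2 hab.le)
      measurableSet_Iic.nullMeasurableSet (by rw [h1]; exact ENNReal.ofReal_ne_top),
      measure_sdiff (Set.Iic_subset_Iic.2 hab.le)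
      measurableSet_Iic.nullMeasurableSet (by rw [h2]; exact ENNReal.ofReal_ne_top)]
    simp only [h1, h2]

/-- The distribution of `π |z| ^ 2` on the set `S`. -/
def radialMeasure (S : Set ℂ) : Measure ℝ :=
  (volume.restrict S).map fun z => π * ‖z‖ ^ 2

theorem radialMeasure_univ_eq : radialMeasure Set.univ = volume.restrict (Set.Ici 0) := by
  rw [radialMeasure, Measure.restrict_univ, map_pi_mul_norm_sq]

theorem radialMeasure_le (S : Set ℂ) : radialMeasure S ≤ volume.restrict (Set.Ici 0) := by
  rw [← map_pi_mul_norm_sq]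
  exact Measure.map_mono Measure.restrict_le_self measurable_pi_mul_norm_sq

theorem radialMeasure_apply_univ (S : Set ℂ) : radialMeasure S Set.univ = volume S := by
  rw [radialMeasure, Measure.map_apply measurable_pi_mul_norm_sq MeasurableSet.univ]
  simp

theorem radialMeasure_ball {r : ℝ} (hr : 0 ≤ r) :
    radialMeasure (Metric.ball 0 r) = volume.restrict (Set.Ico 0 (π * r ^ 2)) := by
  have e : Metric.ball (0 : ℂ) r = (fun z : ℂ => π * ‖z‖ ^ 2) ⁻¹' Set.Iio (π * r ^ 2) := by
    ext z
    rw [mem_ball_zero_iff, Set.mem_preimage, Set.mem_Iio, mul_lt_mul_iff_right₀ pi_pos,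
      pow_lt_pow_iff_left₀ (norm_nonneg _) hr two_ne_zero]
  rw [radialMeasure, e, ← Measure.restrict_map measurable_pi_mul_norm_sq measurableSet_Iio,
    map_pi_mul_norm_sq, Measure.restrict_restrict measurableSet_Iio, Set.inter_comm,
    Set.Ici_inter_Iio]

/-- The eigenvalue of the Toeplitz operator of the radial set `S` at the monomial of degree `k`. -/
def radialEigenvalue (S : Set ℂ) (k : ℕ) : ℝ := ∫ s, poissonWeight k s ∂(radialMeasure S)

theorem radialEigenvalue_eq (S : Set ℂ) (k : ℕ) :
    radialEigenvalue S k = ∫ z in S, poissonWeight k (π * ‖z‖ ^ 2) := by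
  rw [radialEigenvalue, radialMeasure, integral_map measurable_pi_mul_norm_sq.aemeasurable
    (continuous_poissonWeight k).aestronglyMeasurable]

theorem integrableOn_poissonWeight_Ici (k : ℕ) : IntegrableOn (poissonWeight k) (Set.Ici 0) := by
  rw [integrableOn_Ici_iff_integrableOn_Ioi]
  have := (Real.GammaIntegral_convergent (s := k + 1) (by positivity)).div_const (k.factorial : ℝ)
  refine this.congr (ae_of_all _ fun s => ?_)
  simp [poissonWeight]

theorem radialEigenvalue_univ (k : ℕ) : radialEigenvalue Set.univ k = 1 := by
  rw [radialEigenvalue, radialMeasure_univ_eq, integral_Ici_eq_integral_Ioi]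
  have h := Real.Gamma_eq_integral (s := k + 1) (by positivity)
  rw [Real.Gamma_nat_eq_factorial] at h
  simp only [add_sub_cancel_right, Real.rpow_natCast] at h
  simp only [poissonWeight]
  rw [integral_div, ← h, div_self (by positivity)]

theorem integrable_poissonWeight_comp (k : ℕ) :
    Integrable fun z : ℂ => poissonWeight k (π * ‖z‖ ^ 2) := by
  have h := integrableOn_poissonWeight_Ici k
  rw [IntegrableOn, ← map_pi_mul_norm_sq] at h
  exact h.comp_measurable measurable_pi_mul_norm_sq

theorem radialEigenvalue_ball {r : ℝ} (hr : 0 ≤ r) (k : ℕ) :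
    radialEigenvalue (Metric.ball 0 r) k = poissonTail k (π * r ^ 2) := by
  rw [radialEigenvalue, radialMeasure_ball hr, poissonTail_eq_integral,
    intervalIntegral.integral_of_le (by positivity), integral_Ico_eq_integral_Ioo,
    integral_Ioc_eq_integral_Ioo]

theorem radialEigenvalue_pos {S : Set ℂ} (hS : 0 < volume S) (k : ℕ) :
    0 < radialEigenvalue S k := by
  rw [radialEigenvalue_eq, integral_pos_iff_support_of_nonneg
    (fun z => poissonWeight_nonneg k (by positivity))
    (integrable_poissonWeight_comp k).integrableOn]
  have h : ({0}ᶜ : Set ℂ) ⊆ Function.support fun z : ℂ => poissonWeight k (π * ‖z‖ ^ 2) := by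
    intro z hz
    have : 0 < ‖z‖ := norm_pos_iff.2 hz
    exact (poissonWeight_pos k (by positivity)).ne'
  refine lt_of_lt_of_le ?_ (measure_mono h)
  rwa [Measure.restrict_apply (measurableSet_singleton _).compl, Set.inter_comm,
    ← Set.sdiff_eq_compl_inter.trans (Set.inter_comm _ _), measure_sdiff_null (measure_singleton _)]

theorem isFiniteMeasure_radialMeasure {S : Set ℂ} (hS : volume S < ⊤) :
    IsFiniteMeasure (radialMeasure S) :=
  ⟨by rwa [radialMeasure_apply_univ]⟩

/-- The Poisson weights sum to at most `1`, so the entries are summable, with sum at most the area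
of `S`. -/
theorem tendsto_radialEigenvalue {S : Set ℂ} (hS : 0 < volume S) (hS' : volume S < ⊤) :
    Tendsto (radialEigenvalue S) atTop (𝓝 0) := by
  have := isFiniteMeasure_radialMeasure hS'
  refine (summable_of_sum_range_le (c := (radialMeasure S).real Set.univ)
    (fun k => (radialEigenvalue_pos hS k).le) fun n => ?_).tendsto_atTop_zero
  have hi := fun k => integrable_poissonWeight (radialMeasure_le S) k
  simp only [radialEigenvalue]
  rw [← integral_finsetSum _ fun k _ => hi k]
  have h0 : ∀ᵐ s ∂(radialMeasure S), 0 ≤ s :=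
    (Measure.absolutelyContinuous_of_le (radialMeasure_le S)) (ae_restrict_mem measurableSet_Ici)
  calc ∫ s, ∑ k ∈ Finset.range n, poissonWeight k s ∂(radialMeasure S)
      ≤ ∫ _, (1 : ℝ) ∂(radialMeasure S) := by
        refine integral_mono_ae (integrable_finsetSum _ fun k _ => hi k) (integrable_const _) ?_
        filter_upwards [h0] with s hs
        refine le_trans ?_ (sum_poissonWeight_le_one n hs)
        exact Finset.sum_le_sum_of_subset_of_nonneg (Finset.range_subset_range.2 n.le_succ)
          fun k _ _ => poissonWeight_nonneg k hs
    _ = _ := by simp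

/-! ### Rotation averages and Taylor coefficients -/

/-- Averaging over rotations extracts a Taylor coefficient. -/
theorem intervalIntegral_conj_pow_mul {G : ℂ → ℂ} (hG : Differentiable ℂ G) (k : ℕ) (z : ℂ) :
    ∫ θ in (0 : ℝ)..2 * π, conj ((Circle.exp θ : ℂ) * z) ^ k * G ((Circle.exp θ : ℂ) * z) =
      2 * π * (iteratedDeriv k G 0 / k.factorial * (‖z‖ : ℂ) ^ (2 * k)) := by
  have hd : Differentiable ℂ fun u => G (z * u) := hG.comp (differentiable_id.const_mul z)
  have h := hd.differentiableOn.circleIntegral_one_div_sub_center_pow_smul (c := 0) (R := 1)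
    zero_lt_one k
  rw [iteratedDeriv_comp_const_mul (hG.contDiff) z, circleIntegral] at h
  simp only [mul_zero, sub_zero, smul_eq_mul, deriv_circleMap] at h
  -- On the unit circle conjugation is inversion, which turns the integrand into that of Cauchy's
  -- formula for the `k`-th derivative of `u ↦ G (z * u)`.
  have e : ∀ θ : ℝ, conj ((Circle.exp θ : ℂ) * z) ^ k * G ((Circle.exp θ : ℂ) * z) =
      conj z ^ k * Complex.I⁻¹ * (circleMap 0 1 θ * Complex.I *
        (1 / circleMap 0 1 θ ^ (k + 1) * G (z * circleMap 0 1 θ))) := by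
    intro θ
    have h1 : circleMap 0 1 θ = (Circle.exp θ : ℂ) := by simp [circleMap, Circle.coe_exp]
    have h2 : (Circle.exp θ : ℂ) ≠ 0 := Circle.coe_ne_zero _
    have h3 : conj (Circle.exp θ : ℂ) = (Circle.exp θ : ℂ)⁻¹ := by
      rw [← Circle.coe_inv, Circle.coe_inv_eq_conj]
    rw [h1, map_mul, h3, mul_pow, mul_comm z, inv_pow, pow_succ]
    field_simp
  simp only [e]
  rw [intervalIntegral.integral_const_mul, h, pow_mul, ← Complex.conj_mul', mul_pow]
  field_simp

/-- The measure on `S` is rotation invariant, so the integrand may be replaced by its average over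
each circle. This leaves the `k`-th Taylor coefficient of `G` times a Poisson weight in `π |z| ^ 2`.
-/
theorem setIntegral_conj_pow_mul {G : ℂ → ℂ} (hG : Differentiable ℂ G) (k : ℕ) {S : Set ℂ}
    (hS : ∀ u v : ℂ, ‖u‖ = ‖v‖ → u ∈ S → v ∈ S)
    (hi : IntegrableOn (fun z => conj z ^ k * G z * (Real.exp (-π * ‖z‖ ^ 2) : ℝ)) S) :
    ∫ z in S, conj z ^ k * G z * (Real.exp (-π * ‖z‖ ^ 2) : ℝ) =
      iteratedDeriv k G 0 / π ^ k * radialEigenvalue S k := by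
  set φ : ℂ → ℂ := fun z => conj z ^ k * G z * (Real.exp (-π * ‖z‖ ^ 2) : ℝ) with hφ
  have hφc : Continuous φ := by
    have := hG.continuous
    simp only [hφ]
    fun_prop
  set μ : Measure ℂ := volume.restrict S with hμ
  set τ : Measure ℝ := volume.restrict (Set.Ioc 0 (2 * π)) with hτ
  have hmp : ∀ θ : ℝ, MeasurePreserving (rotation (Circle.exp θ)) μ μ := by
    intro θ
    have h1 := (rotation (Circle.exp θ)).measurePreserving.restrict_preimage_emb
      (rotation (Circle.exp θ)).toHomeomorph.measurableEmbedding S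
    have h2 : rotation (Circle.exp θ) ⁻¹' S = S := by
      ext z
      rw [Set.mem_preimage]
      exact ⟨hS _ _ (LinearIsometryEquiv.norm_map _ _),
        hS _ _ (LinearIsometryEquiv.norm_map _ _).symm⟩
    rwa [h2] at h1
  have hemb : ∀ θ : ℝ, MeasurableEmbedding (rotation (Circle.exp θ)) := fun θ =>
    (rotation (Circle.exp θ)).toHomeomorph.measurableEmbedding
  have hint : ∀ θ : ℝ, ∫ z, φ ((Circle.exp θ : ℂ) * z) ∂μ = ∫ z, φ z ∂μ := fun θ =>
    (hmp θ).integral_comp (hemb θ) φ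
  have hnorm : ∀ θ : ℝ, ∫ z, ‖φ ((Circle.exp θ : ℂ) * z)‖ ∂μ = ∫ z, ‖φ z‖ ∂μ := fun θ =>
    (hmp θ).integral_comp (hemb θ) fun z => ‖φ z‖
  have hcont : Continuous fun p : ℝ × ℂ => φ ((Circle.exp p.1 : ℂ) * p.2) := by
    refine hφc.comp (Continuous.mul ?_ continuous_snd)
    exact continuous_subtype_val.comp (Circle.exp.continuous.comp continuous_fst)
  have hprod : Integrable (fun p : ℝ × ℂ => φ ((Circle.exp p.1 : ℂ) * p.2)) (τ.prod μ) := by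
    rw [integrable_prod_iff hcont.aestronglyMeasurable]
    refine ⟨ae_of_all _ fun θ => ?_, ?_⟩
    · exact (hmp θ).integrable_comp_of_integrable hi
    · simp only [hnorm]
      exact integrable_const _
  have hswap := integral_integral_swap (f := fun θ z => φ ((Circle.exp θ : ℂ) * z)) hprod
  have hl : ∫ θ, (∫ z, φ ((Circle.exp θ : ℂ) * z) ∂μ) ∂τ = 2 * π * ∫ z, φ z ∂μ := by
    simp only [hint]
    rw [integral_const]
    have : τ.real Set.univ = 2 * π := by
      simp [hτ, Measure.real, Real.pi_pos.le]
    rw [this]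
    simp
  have hr : ∀ z : ℂ, ∫ θ, φ ((Circle.exp θ : ℂ) * z) ∂τ =
      2 * π * (iteratedDeriv k G 0 / π ^ k * (poissonWeight k (π * ‖z‖ ^ 2) : ℝ)) := by
    intro z
    have h1 : ∀ θ : ℝ, φ ((Circle.exp θ : ℂ) * z) = conj ((Circle.exp θ : ℂ) * z) ^ k *
        G ((Circle.exp θ : ℂ) * z) * (Real.exp (-π * ‖z‖ ^ 2) : ℝ) := fun θ => by
      simp only [hφ, norm_mul, Circle.norm_coe, one_mul]
    simp only [h1]
    rw [integral_mul_const, hτ, ← intervalIntegral.integral_of_le (by positivity),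
      intervalIntegral_conj_pow_mul hG]
    have hk : (k.factorial : ℂ) ≠ 0 := by exact_mod_cast k.factorial_ne_zero
    have hp : (π : ℂ) ≠ 0 := by exact_mod_cast pi_ne_zero
    simp only [poissonWeight]
    push_cast
    rw [mul_pow, ← pow_mul, neg_mul]
    field_simp
  rw [hl] at hswap
  simp only [hr] at hswap
  rw [integral_const_mul, integral_const_mul, integral_complex_ofReal,
    ← radialEigenvalue_eq] at hswap
  exact mul_left_cancel₀ (by simp [pi_ne_zero]) hswap


/-! ### Diagonalization of the Toeplitz operator -/

/-- The basis function `(z - w) ^ k * exp (π w̄ z)` of the Fock space centered at `w`. -/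
def basisFun (w : ℂ) (k : ℕ) (z : ℂ) : ℂ := (z - w) ^ k * Complex.exp (π * conj w * z)

theorem differentiable_basisFun (w : ℂ) (k : ℕ) : Differentiable ℂ (basisFun w k) := by
  unfold basisFun; fun_prop

/-- The entire function obtained from `f` by moving the center `w` to the origin. -/
def recenter (w : ℂ) (f : ℂ → ℂ) (u : ℂ) : ℂ := f (u + w) * Complex.exp (-(π * conj w * u))

theorem differentiable_recenter (w : ℂ) {f : ℂ → ℂ} (hf : Differentiable ℂ f) :
    Differentiable ℂ (recenter w f) := by
  unfold recenter; fun_prop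

/-- The factor `exp (π w̄ z)` is chosen so that `-π |u + w|² + π w (ū + w̄) = -π |u|² - π w̄ u`:
pairings with the basis at `w` become pairings of `recenter w f` with monomials at the origin. -/
theorem exp_smul_conj_basisFun_mul (w : ℂ) (k : ℕ) (f : ℂ → ℂ) (u : ℂ) :
    (ENNReal.ofReal (Real.exp (-π * ‖u + w‖ ^ 2))).toReal •
        (conj (basisFun w k (u + w)) * f (u + w)) =
      conj u ^ k * recenter w f u * (Real.exp (-π * ‖u‖ ^ 2) : ℝ) := by
  rw [ENNReal.toReal_ofReal (Real.exp_pos _).le, Complex.real_smul, basisFun, recenter,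
    add_sub_cancel_right, map_mul, map_pow, ← Complex.exp_conj]
  push_cast
  rw [← Complex.conj_mul' (u + w), ← Complex.conj_mul' u]
  have e : Complex.exp (-(π : ℂ) * (conj (u + w) * (u + w))) *
      Complex.exp (conj ((π : ℂ) * conj w * (u + w))) =
      Complex.exp (-(π * conj w * u)) * Complex.exp (-(π : ℂ) * (conj u * u)) := by
    rw [← Complex.exp_add, ← Complex.exp_add]
    congr 1
    simp only [map_mul, map_add, Complex.conj_conj, Complex.conj_ofReal]
    ring
  linear_combination (conj u ^ k * f (u + w)) * e

theorem recenter_basisFun (w : ℂ) (k : ℕ) (u : ℂ) :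
    recenter w (basisFun w k) u = u ^ k * Complex.exp (π * conj w * w) := by
  rw [recenter, basisFun, add_sub_cancel_right, mul_assoc, ← Complex.exp_add]
  congr 2
  ring

theorem density_lt_top : ∀ᵐ z : ℂ, ENNReal.ofReal (Real.exp (-π * ‖z‖ ^ 2)) < ⊤ :=
  ae_of_all _ fun _ => ENNReal.ofReal_lt_top

theorem memLp_basisFun (w : ℂ) (k : ℕ) : MemLp (basisFun w k) 2 gaussian := by
  rw [memLp_two_iff_integrable_sq_norm
    (differentiable_basisFun w k).continuous.aestronglyMeasurable, gaussian,
    integrable_withDensity_iff_integrable_smul' measurable_density density_lt_top]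
  have h := ((integrable_poissonWeight_comp k).const_mul
    (k.factorial / π ^ k * Real.exp (π * ‖w‖ ^ 2))).comp_sub_right w
  refine h.congr (ae_of_all _ fun z => ?_)
  have h1 := exp_smul_conj_basisFun_mul w k (basisFun w k) (z - w)
  rw [recenter_basisFun, sub_add_cancel, Complex.conj_mul', mul_assoc (π : ℂ), Complex.conj_mul',
    ← mul_assoc, ← mul_pow, Complex.conj_mul', Complex.real_smul] at h1
  have h2 : (ENNReal.ofReal (Real.exp (-π * ‖z‖ ^ 2))).toReal * ‖basisFun w k z‖ ^ 2 =
      (‖z - w‖ ^ 2) ^ k * Real.exp (π * ‖w‖ ^ 2) * Real.exp (-π * ‖z - w‖ ^ 2) := by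
    exact_mod_cast h1
  simp only [smul_eq_mul]
  rw [h2, poissonWeight, mul_pow, neg_mul]
  field_simp

/-- The basis functions as elements of the Fock space. -/
def basis (w : ℂ) (k : ℕ) : fockSpace :=
  ⟨(memLp_basisFun w k).toLp (basisFun w k), basisFun w k, differentiable_basisFun w k,
    (memLp_basisFun w k).coeFn_toLp⟩

theorem coe_basis_ae_eq (w : ℂ) (k : ℕ) :
    ((basis w k : fockSpace) : Lp ℂ 2 gaussian) =ᵐ[gaussian] basisFun w k :=
  (memLp_basisFun w k).coeFn_toLp

theorem mulIndicator_ae_eq {Ω : Set ℂ} (hΩ : NullMeasurableSet Ω) (f : Lp ℂ 2 gaussian) :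
    mulIndicator Ω hΩ f =ᵐ[gaussian] Ω.indicator f :=
  (memLp_indicator hΩ f).coeFn_toLp

theorem inner_basis_mulIndicator (w : ℂ) (k : ℕ) {Ω : Set ℂ} (hΩ : NullMeasurableSet Ω)
    (hrad : ∀ u v : ℂ, ‖u‖ = ‖v‖ → u + w ∈ Ω → v + w ∈ Ω) (f : Lp ℂ 2 gaussian) {F : ℂ → ℂ}
    (hF : Differentiable ℂ F) (hf : f =ᵐ[gaussian] F) :
    inner ℂ (basis w k : Lp ℂ 2 gaussian) (mulIndicator Ω hΩ f) =
      iteratedDeriv k (recenter w F) 0 / π ^ k * radialEigenvalue {u | u + w ∈ Ω} k := by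
  set S : Set ℂ := {u | u + w ∈ Ω} with hS
  have hSm : NullMeasurableSet S :=
    hΩ.preimage (measurePreserving_add_right volume w).quasiMeasurePreserving
  set ψ : ℂ → ℂ := fun u => conj u ^ k * recenter w F u * (Real.exp (-π * ‖u‖ ^ 2) : ℝ) with hψ
  have hae : (fun z => inner ℂ ((basis w k : Lp ℂ 2 gaussian) z) (mulIndicator Ω hΩ f z))
      =ᵐ[gaussian] fun z => conj (basisFun w k z) * Ω.indicator F z := by
    filter_upwards [coe_basis_ae_eq w k, mulIndicator_ae_eq hΩ f, hf] with z h1 h2 h3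
    rw [h1, h2, RCLike.inner_apply']
    congr 1
    by_cases h : z ∈ Ω
    · rw [Set.indicator_of_mem h, Set.indicator_of_mem h, h3]
    · rw [Set.indicator_of_notMem h, Set.indicator_of_notMem h]
  have hpt : ∀ u, (ENNReal.ofReal (Real.exp (-π * ‖u + w‖ ^ 2))).toReal •
      (conj (basisFun w k (u + w)) * Ω.indicator F (u + w)) = S.indicator ψ u := by
    intro u
    by_cases h : u ∈ S
    · rw [Set.indicator_of_mem h, Set.indicator_of_mem (show u + w ∈ Ω from h),
        exp_smul_conj_basisFun_mul]
    · rw [Set.indicator_of_notMem h, Set.indicator_of_notMem (show u + w ∉ Ω from h), mul_zero,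
        smul_zero]
  have hi : IntegrableOn ψ S := by
    have h1 := (L2.integrable_inner (𝕜 := ℂ) (basis w k : Lp ℂ 2 gaussian)
      (mulIndicator Ω hΩ f)).congr hae
    rw [gaussian, integrable_withDensity_iff_integrable_smul' measurable_density
      density_lt_top] at h1
    have h2 := h1.comp_add_right w
    simp only [hpt] at h2
    refine (h2.integrableOn (s := S)).congr ?_
    filter_upwards [ae_restrict_mem₀ hSm] with u hu
    exact Set.indicator_of_mem hu ψ
  rw [L2.inner_def, integral_congr_ae hae, gaussian,
    integral_withDensity_eq_integral_toReal_smul measurable_density density_lt_top,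
    ← integral_add_right_eq_self _ w]
  simp only [hpt]
  rw [integral_indicator₀ hSm]
  exact setIntegral_conj_pow_mul (differentiable_recenter w hF) k
    (fun u v huv hu => hrad u v huv hu) hi

theorem mulIndicator_univ (f : Lp ℂ 2 gaussian) :
    mulIndicator Set.univ MeasurableSet.univ.nullMeasurableSet f = f := by
  refine Lp.ext ((mulIndicator_ae_eq _ f).trans ?_)
  rw [Set.indicator_univ]

theorem inner_basis (w : ℂ) (k : ℕ) (f : Lp ℂ 2 gaussian) {F : ℂ → ℂ}
    (hF : Differentiable ℂ F) (hf : f =ᵐ[gaussian] F) :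
    inner ℂ (basis w k : Lp ℂ 2 gaussian) f = iteratedDeriv k (recenter w F) 0 / π ^ k := by
  have h := inner_basis_mulIndicator w k MeasurableSet.univ.nullMeasurableSet
    (fun _ _ _ _ => Set.mem_univ _) f hF hf
  rw [mulIndicator_univ] at h
  have e : {u : ℂ | u + w ∈ Set.univ} = Set.univ := by ext; simp
  rw [h, e, radialEigenvalue_univ]
  simp

theorem inner_basis_basis (w : ℂ) (k l : ℕ) :
    inner ℂ (basis w k) (basis w l) =
      (if k = l then (k.factorial : ℂ) else 0) * Complex.exp (π * conj w * w) / π ^ k := by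
  rw [Submodule.coe_inner, inner_basis w k _ (differentiable_basisFun w l) (coe_basis_ae_eq w l)]
  congr 1
  have e : recenter w (basisFun w l) = fun u => Complex.exp (π * conj w * w) * u ^ l := by
    ext u; rw [recenter_basisFun, mul_comm]
  rw [e, iteratedDeriv_const_mul_field, iteratedDeriv_fun_pow_zero, mul_comm]
  split_ifs with h
  · rw [h]
  · simp

/-- Pairing with `basis w k` reads off the `k`-th Taylor coefficient of `recenter w F`; cutting off
to `Ω` only multiplies it by the radial eigenvalue, and the projection is invisible to elements of
the Fock space. Completeness holds because an entire function with zero Taylor series vanishes. -/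
theorem isDiagonalIn_toeplitz (w : ℂ) {Ω : Set ℂ} (hΩ : NullMeasurableSet Ω)
    (hrad : ∀ u v : ℂ, ‖u‖ = ‖v‖ → u + w ∈ Ω → v + w ∈ Ω) :
    IsDiagonalIn (toeplitz Ω hΩ) (basis w) (radialEigenvalue {u | u + w ∈ Ω}) where
  ne_zero k h := by
    have h1 := inner_basis_basis w k k
    rw [h, inner_zero_left, if_pos rfl] at h1
    have hk : (k.factorial : ℂ) ≠ 0 := by exact_mod_cast k.factorial_ne_zero
    have hp : (π : ℂ) ^ k ≠ 0 := pow_ne_zero _ (by exact_mod_cast pi_ne_zero)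
    exact div_ne_zero (mul_ne_zero hk (Complex.exp_ne_zero _)) hp h1.symm
  orthogonal k l hkl := by
    rw [inner_basis_basis, if_neg hkl]
    simp
  complete f hf := by
    obtain ⟨f, F, hF, hfF⟩ := f
    have h0 : ∀ k, iteratedDeriv k (recenter w F) 0 = 0 := by
      intro k
      have h1 := hf k
      rw [Submodule.coe_inner, inner_basis w k f hF hfF, div_eq_zero_iff] at h1
      exact h1.resolve_right (pow_ne_zero _ (by exact_mod_cast pi_ne_zero))
    have h2 : ∀ u, recenter w F u = 0 := by
      intro u
      rw [← Complex.taylorSeries_eq_of_entire (differentiable_recenter w hF) 0 u]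
      simp [h0]
    have h3 : F = 0 := by
      ext z
      have := h2 (z - w)
      rw [recenter, sub_add_cancel] at this
      exact (mul_eq_zero.1 this).resolve_right (Complex.exp_ne_zero _)
    refine Subtype.ext (Lp.ext (hfF.trans ?_))
    rw [h3]
    exact (Lp.coeFn_zero _ _ _).symm
  inner_apply k f := by
    obtain ⟨f, F, hF, hfF⟩ := f
    have h1 : inner ℂ (basis w k) (toeplitz Ω hΩ ⟨f, F, hF, hfF⟩) =
        inner ℂ (basis w k : Lp ℂ 2 gaussian) (mulIndicator Ω hΩ f) :=
      Submodule.inner_orthogonalProjectionOnto_eq_of_mem_left (basis w k) _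
    rw [h1, inner_basis_mulIndicator w k hΩ hrad f hF hfF, Submodule.coe_inner,
      inner_basis w k f hF hfF]
    ring

end Fock
end

/-! ### Comparison with the disc -/

theorem corollary3p1 (Ω : Set ℂ) (hΩ : Fock.IsCircularlySymmetric Ω)
    (hpos : 0 < MeasureTheory.volume Ω) (hfin : MeasureTheory.volume Ω < ⊤)
    (c : ℂ) (r : ℝ)
    (hball : MeasureTheory.volume (Metric.ball c r) = MeasureTheory.volume Ω)
    (n : ℕ) (hn : 1 ≤ n) (f : (Fin n → ℝ) → ℝ) (hf : Fock.IsSymmetricGauge f) :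
    f (fun i => Fock.eigenvalueDecr (Fock.toeplitz Ω hΩ.nullMeasurableSet) (i + 1)) ≤
      f (fun i => Fock.eigenvalueDecr
        (Fock.toeplitz (Metric.ball c r) measurableSet_ball.nullMeasurableSet) (i + 1)) := by
  obtain ⟨w, E, -, -, hE⟩ := hΩ.exists_eq
  set S : Set ℂ := {u | u + w ∈ Ω} with hS
  have hSvol : volume S = volume Ω := measure_preimage_add_right volume w Ω
  have hr : 0 < r := by
    by_contra h
    rw [← hball, Metric.ball_eq_empty.2 (not_lt.1 h), measure_empty] at hpos
    exact lt_irrefl _ hpos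
  have hT := Fock.isDiagonalIn_toeplitz w hΩ.nullMeasurableSet (fun u v huv hu => by
    rw [hE] at hu ⊢
    simpa [← huv] using hu)
  have hT' := Fock.isDiagonalIn_toeplitz c (Ω := Metric.ball c r)
    measurableSet_ball.nullMeasurableSet (fun u v huv hu => by
      simpa [← huv] using hu)
  have hB : {u : ℂ | u + c ∈ Metric.ball c r} = Metric.ball 0 r := by
    ext u; simp
  rw [hB] at hT'
  have hSpos : 0 < volume S := by rwa [hSvol]
  have hSfin : volume S < ⊤ := by rwa [hSvol]
  have := Fock.isFiniteMeasure_radialMeasure hSfin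
  have hmass : (Fock.radialMeasure S).real Set.univ = π * r ^ 2 := by
    rw [Measure.real, Fock.radialMeasure_apply_univ, hSvol, ← hball, Complex.volume_ball]
    simp [hr.le, mul_comm]
  have hμ := Fock.radialEigenvalue_pos hSpos
  have hlim := Fock.tendsto_radialEigenvalue hSpos hSfin
  have hanti : Antitone (Fock.radialEigenvalue (Metric.ball 0 r)) := by
    refine antitone_nat_of_succ_le fun k => ?_
    rw [Fock.radialEigenvalue_ball hr.le, Fock.radialEigenvalue_ball hr.le]
    exact Fock.poissonTail_succ_le k (by positivity)
  refine hf.le_of_partial_sums_le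
    (x := fun i => Fock.eigenvalueDecr (Fock.toeplitz Ω hΩ.nullMeasurableSet) (i + 1))
    (y := fun i => Fock.eigenvalueDecr
        (Fock.toeplitz (Metric.ball c r) measurableSet_ball.nullMeasurableSet) (i + 1))
    (fun i j hij => hT.eigenvalueDecr_antitone hμ hlim.bddAbove_range (Nat.succ_le_succ hij))
    (fun i => hT.eigenvalueDecr_nonneg hμ _) fun j _ => ?_
  -- The diagonal entries of `Ω` need not be ordered in `k`, hence an arbitrary index set `K`. For
  -- the disc they are, and only the lower bound of its ordered eigenvalues by the Poisson tails is
  -- used.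
  obtain ⟨K, hK, hle⟩ := hT.exists_sum_eigenvalueDecr_le hμ hlim j
  refine hle.trans ((Fock.sum_integral_poissonWeight_le (Fock.radialMeasure_le S) K).trans ?_)
  rw [hmass, hK]
  refine Finset.sum_le_sum fun k _ => ?_
  rw [← Fock.radialEigenvalue_ball hr.le]
  exact hT'.le_eigenvalueDecr hanti k
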